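/- Let $N\ge 1$ and $0<\sigma<1/2$. For $\mathbf n=(n_1,\dots,n_N)\in\mathbb Z^N$ put $|\mathbf n|=|n_1|+\cdots+|n_N|$. Let $G_{t,N}(\mathbf n)=\prod_{i=1}^N e^{-2t}I_{n_i}(2t)$, where $I_a$ is the modified Bessel function of the first kind, let $W_tf(\mathbf n)=\sum_{\mathbf k\in\mathbb Z^N}G_{t,N}(\mathbf n-\mathbf k)f(\mathbf k)$ be the heat semigroup of the discrete Laplacian $\Delta_N f(\mathbf n)=\sum_{i=1}^N\big(f(\mathbf n+\mathbf e_i)-2f(\mathbf n)+f(\mathbf n-\mathbf e_i)\big)$, and define \[(-\Delta_N)^{-\sigma}f(\mathbf n)=\frac1{\Gamma(\sigma)}\int_0^\infty W_tf(\mathbf n)\,t^{\sigma-1}\,dt .\] Let $\ell_\sigma(\mathbb Z^N)$ be the space of real or complex sequences $f$ on $\mathbb Z^N$ with $\sum_{\mathbf n}|f(\mathbf n)|(1+|\mathbf n|)^{2\sigma-N}<\infty$. With $\delta_i^+f(\mathbf n)=f(\mathbf n+\mathbf e_i)-f(\mathbf n)$, an integer $k\ge0$ and $0<\alpha\le1$,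 let \[[f]_{C^{0,\alpha}}=\sup_{\mathbf n\ne\mathbf m}\frac{|f(\mathbf n)-f(\mathbf m)|}{|\mathbf n-\mathbf m|^\alpha},\qquad [f]_{C^{k,\alpha}}=\sum_{m_1+\cdots+m_N=k}\big[(\delta_1^+)^{m_1}\cdots(\delta_N^+)^{m_N}f\big]_{C^{0,\alpha}},\] and let $C^{k,\alpha}(\mathbb Z^N)$ be the set of all $f$ with $[f]_{C^{k,\alpha}}<\infty$. For every $f\in\ell_\sigma(\mathbb Z^N)$ and $\mathbf n\in\mathbb Z^N$, the series defining $W_tf(\mathbf n)$ (for every $t>0$) and the integral defining $(-\Delta_N)^{-\sigma}f(\mathbf n)$ converge absolutely. Moreover, for every integer $k\ge0$ and every $0<\alpha\le1$: (a) If $2\sigma+\alpha<1$, there is a constant $C=C(N,\sigma,k,\alpha)$ such that for every $f\in\ell_\sigma(\mathbb Z^N)\cap C^{k,\alpha}(\mathbb Z^N)$ one has $(-\Delta_N)^{-\sigma}f\in C^{k,2\sigma+\alpha}(\mathbb Z^N)$ and \[[(-\Delta_N)^{-\sigma}f]_{C^{k,2\sigma+\alpha}}\le C\,[f]_{C^{k,\alpha}}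 .\] (b) If $2\sigma+\alpha>1$, there is a constant $C=C(N,\sigma,k,\alpha)$ such that for every $f\in\ell_\sigma(\mathbb Z^N)\cap C^{k,\alpha}(\mathbb Z^N)$ one has $(-\Delta_N)^{-\sigma}f\in C^{k+1,2\sigma+\alpha-1}(\mathbb Z^N)$ and \[[(-\Delta_N)^{-\sigma}f]_{C^{k+1,2\sigma+\alpha-1}}\le C\,[f]_{C^{k,\alpha}} .\] (c) There is a constant $C=C(N,\sigma)$ such that for every $f\in\ell_\sigma(\mathbb Z^N)\cap\ell^\infty(\mathbb Z^N)$ one has $(-\Delta_N)^{-\sigma}f\in C^{0,2\sigma}(\mathbb Z^N)$ and \[[(-\Delta_N)^{-\sigma}f]_{C^{0,2\sigma}}\le C\,\|f\|_{\ell^\infty(\mathbb Z^N)} .\] -/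

import Mathlib

open MeasureTheory
open scoped ENNReal NNReal

noncomputable section

namespace DiscreteLaplacian

/-- The length `|n| = |n₁| + ⋯ + |n_N|` on the lattice `ℤ^N`. -/
def latticeNorm {N : ℕ} (n : Fin N → ℤ) : ℝ := ∑ i, |(n i : ℝ)|

/-- The modified Bessel function of the first kind
`I_a(x) = ∑_k (x/2)^(2k+a) / (k! Γ(a+k+1))`. Since `Real.Gamma` vanishes by convention at
its poles, `(Real.Gamma _)⁻¹` is the entire function `1/Γ`, zero at those poles, as required. -/
def besselI (a x : ℝ) : ℝ :=
  ∑' k : ℕ, (Real.Gamma (a + k + 1))⁻¹ / (k.factorial : ℝ) * (x / 2) ^ (2 * (k : ℝ) + a)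

/-- The heat kernel `G_{t,N}(n) = ∏_i e^{-2t} I_{n_i}(2t)`. -/
def heatKernel {N : ℕ} (t : ℝ) (n : Fin N → ℤ) : ℝ :=
  ∏ i, Real.exp (-2 * t) * besselI (n i : ℝ) (2 * t)

variable {N : ℕ} {E : Type*} [NormedAddCommGroup E] [NormedSpace ℝ E]

/-- The heat semigroup `W_t f(n) = ∑_k G_{t,N}(n - k) f(k)`. -/
def heatSemigroup (t : ℝ) (f : (Fin N → ℤ) → E) (n : Fin N → ℤ) : E :=
  ∑' k : Fin N → ℤ, heatKernel t (n - k) • f k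

/-- The fractional integral
`(-Δ_N)^{-σ} f(n) = Γ(σ)⁻¹ ∫_0^∞ W_t f(n) t^{σ-1} dt`. -/
def fracIntegral (σ : ℝ) (f : (Fin N → ℤ) → E) (n : Fin N → ℤ) : E :=
  (Real.Gamma σ)⁻¹ • ∫ t in Set.Ioi (0 : ℝ), t ^ (σ - 1) • heatSemigroup t f n

/-- `f ∈ ℓ_σ(ℤ^N)`, the weighted `ℓ^1` space with weight `(1 + |n|)^{2σ - N}`. -/
def MemEll (σ : ℝ) (f : (Fin N → ℤ) → E) : Prop :=
  Summable fun n : Fin N → ℤ => ‖f n‖ * (1 + latticeNorm n) ^ (2 * σ - N)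

/-- The forward difference `δ_i^+ f(n) = f(n + e_i) - f(n)`. -/
def diff (i : Fin N) (f : (Fin N → ℤ) → E) : (Fin N → ℤ) → E :=
  fwdDiff (Pi.single i 1) f

/-- `(δ_1^+)^{m_1} (δ_2^+)^{m_2} ⋯ (δ_N^+)^{m_N} f`. -/
def iterDiff (m : Fin N → ℕ) (f : (Fin N → ℤ) → E) : (Fin N → ℤ) → E :=
  (List.finRange N).foldr (fun i g => (diff i)^[m i] g) f

/-- The seminorm `[f]_{C^{0,α}} = sup_{n ≠ m} |f(n) - f(m)| / |n - m|^α`. -/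
def holderSeminormZero (α : ℝ) (f : (Fin N → ℤ) → E) : ℝ≥0∞ :=
  ⨆ (n : Fin N → ℤ) (m : Fin N → ℤ) (_ : n ≠ m),
    ENNReal.ofReal (‖f n - f m‖ / latticeNorm (n - m) ^ α)

/-- The seminorm `[f]_{C^{k,α}}`: the sum of the `C^{0,α}` seminorms of
`(δ_1^+)^{m_1} ⋯ (δ_N^+)^{m_N} f` over all `m ∈ ℕ^N` with `m_1 + ⋯ + m_N = k`. -/
def holderSeminorm (k : ℕ) (α : ℝ) (f : (Fin N → ℤ) → E) : ℝ≥0∞ :=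
  ∑ m ∈ Finset.piAntidiag (Finset.univ : Finset (Fin N)) k, holderSeminormZero α (iterDiff m f)

/-- `f ∈ C^{k,α}(ℤ^N)`. -/
def MemHolder (k : ℕ) (α : ℝ) (f : (Fin N → ℤ) → E) : Prop :=
  holderSeminorm k α f < ∞

end DiscreteLaplacian

end

open MeasureTheory
open scoped ENNReal NNReal


/-! ### Poisson weights and their sup bound -/

namespace DiscreteLaplacian

/-! The function `e^{-2t} I_a(2t)` of `a` is the law of `X - Y` for independent Poisson variables
`X`, `Y` of mean `t`. Hence `W_t f(n)` is the expectation of `f(n - X + Y)` over `2N` independent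
Poisson variables (`hasSum_heatKernel`, `MemEll.hasSum_heatSemigroup`), and every estimate becomes a
moment computation with countable sums.

Convergence: exponential tilting gives the kernel bounds `t^{-N/2}` and, uniformly in `t`,
`(1+|n|)^{-N}`. Integrated against `t^{σ-1}` on either side of `t = (1+|n|)²`, they give a kernel of
size `(1+|n|)^{2σ-N}`, which is exactly the weight of `ℓ_σ`; here `2σ < 1 ≤ N`.

Regularity: Stein's identity for the Poisson law (`hasSum_dev_smul`) moves a difference from `W_t f`
onto the weight `X_i/t - 1` or `Y_i/t - 1`. This weight has mean zero, so a constant may be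
subtracted from `f`, and its size is `t^{-1/2}`, while displacements have size `√t`. For `α`-Hölder
`f`, first and second differences of `W_t f` are therefore `O(t^{(α-1)/2})` and `O(t^{α/2-1})`, and
`W_t` preserves the Hölder constant. Splitting the time integral at `t = |n-m|²` gives (a) and (b)
for `k = 0`. The operator commutes with differences (`MemEll.memEll_iterDiff`), which gives all `k`;
(c) is the argument of (a) with `α = 0`. -/

lemma hasSum_of_eq {ι E : Type*} [NormedAddCommGroup E] {f g : ι → E} {a b : E}
    (h : HasSum f a) (hfg : ∀ x, f x = g x) (hab : a = b) : HasSum g b :=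
  hab ▸ (funext hfg : f = g) ▸ h

/-- The Poisson weights `e^{-t} t^k / k!`. -/
noncomputable def pois (t : ℝ) (k : ℕ) : ℝ := Real.exp (-t) * (t ^ k / (k.factorial : ℝ))

lemma pois_nonneg {t : ℝ} (ht : 0 ≤ t) (k : ℕ) : 0 ≤ pois t k := by
  unfold pois; positivity

lemma hasSum_pois (t : ℝ) : HasSum (pois t) 1 := by
  have h := (NormedSpace.expSeries_div_hasSum_exp (𝔸 := ℝ) t).mul_left (Real.exp (-t))
  rwa [← Real.exp_eq_exp_ℝ, ← Real.exp_add, neg_add_cancel, Real.exp_zero] at h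

lemma pois_succ_mul (t : ℝ) (k : ℕ) : pois t (k + 1) * ((k : ℝ) + 1) = t * pois t k := by
  have h1 : ((k.factorial : ℕ) : ℝ) ≠ 0 := by positivity
  have h2 : (k : ℝ) + 1 ≠ 0 := by positivity
  unfold pois
  rw [Nat.factorial_succ]
  push_cast
  field_simp
  ring

lemma hasSum_pois_mul_id (t : ℝ) : HasSum (fun k : ℕ => pois t k * k) t := by
  rw [← hasSum_nat_add_iff' 1]
  have h := (hasSum_pois t).mul_left t
  simp only [Finset.range_one, Finset.sum_singleton, Nat.cast_zero, mul_zero, sub_zero]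
  refine hasSum_of_eq h (fun k => ?_) (by ring)
  push_cast
  exact (pois_succ_mul t k).symm

lemma hasSum_pois_mul_sq (t : ℝ) : HasSum (fun k : ℕ => pois t k * (k : ℝ) ^ 2) (t ^ 2 + t) := by
  rw [← hasSum_nat_add_iff' 1]
  have h := ((hasSum_pois_mul_id t).add (hasSum_pois t)).mul_left t
  simp only [Finset.range_one, Finset.sum_singleton, Nat.cast_zero, ne_eq, OfNat.ofNat_ne_zero,
    not_false_eq_true, zero_pow, mul_zero, sub_zero]
  refine hasSum_of_eq h (fun k => ?_) (by ring)
  have := pois_succ_mul t k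
  push_cast
  linear_combination -((k : ℝ) + 1) * this

lemma hasSum_pois_variance {t : ℝ} (ht : 0 < t) :
    HasSum (fun k : ℕ => pois t k * (1 - k / t) ^ 2) (1 / t) := by
  have h := ((hasSum_pois t).sub ((hasSum_pois_mul_id t).mul_left (2 / t))).add
    ((hasSum_pois_mul_sq t).mul_left (1 / t ^ 2))
  refine hasSum_of_eq h (fun k => ?_) ?_
  · field_simp
    ring
  · field_simp
    ring

/-- Telescoping: `pois t j * (j / t)` is `pois t (j - 1)` for `j ≥ 1`. It writes a single weight as
a truncated first moment. -/
lemma sum_pois_mul_one_sub {t : ℝ} (ht : 0 < t) (k : ℕ) :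
    ∑ j ∈ Finset.range (k + 1), pois t j * (1 - j / t) = pois t k := by
  induction k with
  | zero => simp
  | succ k ih =>
    rw [Finset.sum_range_succ, ih]
    have := pois_succ_mul t k
    push_cast
    field_simp
    linear_combination -this

lemma pois_le_one {t : ℝ} (ht : 0 ≤ t) (k : ℕ) : pois t k ≤ 1 :=
  le_hasSum (hasSum_pois t) k fun j _ => pois_nonneg ht j

/-- The truncated first moment of `1 - j/t` is controlled by its variance `1/t` through `x ≤ (s x² +
1/s)/2`; this gives the `t^{-1/2}` decay of the mode without Stirling's formula. -/
lemma pois_le_inv {t s : ℝ} (hs : 0 < s) (hst : s ^ 2 ≤ t) (k : ℕ) : pois t k ≤ 1 / s := by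
  have ht : 0 < t := lt_of_lt_of_le (by positivity) hst
  rw [← sum_pois_mul_one_sub ht k]
  have h := (((hasSum_pois_variance ht).mul_left s).add
    ((hasSum_pois t).mul_left (1 / s))).mul_left (1 / 2)
  have hle : (1 / 2) * (s * (1 / t) + 1 / s * 1) ≤ 1 / s := by
    have : s * (1 / t) ≤ 1 / s := by
      rw [mul_one_div, div_le_div_iff₀ ht hs]
      nlinarith
    linarith
  refine le_trans (Finset.sum_le_sum (g := fun j => (1 / 2) *
    (s * (pois t j * (1 - j / t) ^ 2) + 1 / s * pois t j)) fun j _ => ?_)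
    ((sum_le_hasSum _ (fun j _ => ?_) h).trans hle)
  · have h1 : (1 - (j : ℝ) / t) ≤ (1 / 2) * (s * (1 - j / t) ^ 2 + 1 / s) := by
      have : (1 / 2) * (s * (1 - j / t) ^ 2 + 1 / s) - (1 - (j : ℝ) / t)
          = (1 / (2 * s)) * (s * (1 - j / t) - 1) ^ 2 := by
        field_simp
        ring
      have h2 : 0 ≤ (1 / (2 * s)) * (s * (1 - j / t) - 1) ^ 2 := by positivity
      linarith
    nlinarith [mul_le_mul_of_nonneg_left h1 (pois_nonneg ht.le j)]
  · have := pois_nonneg ht.le j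
    positivity

/-- The one-dimensional weights of a pair of independent Poisson variables. -/
noncomputable def poisPair (t : ℝ) (z : ℕ × ℕ) : ℝ := pois t z.1 * pois t z.2

lemma poisPair_nonneg {t : ℝ} (ht : 0 ≤ t) (z : ℕ × ℕ) : 0 ≤ poisPair t z :=
  mul_nonneg (pois_nonneg ht _) (pois_nonneg ht _)

lemma hasSum_poisPair {t : ℝ} (ht : 0 ≤ t) : HasSum (poisPair t) 1 := by
  have hs := (hasSum_pois t).summable.mul_of_nonneg (hasSum_pois t).summable
    (fun k => pois_nonneg ht k) (fun k => pois_nonneg ht k)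
  exact hasSum_of_eq ((hasSum_pois t).mul (hasSum_pois t) hs) (fun z => rfl) (mul_one 1)

/-! ### The Bessel kernel as a law of Poisson differences -/

lemma besselI_term {t : ℝ} (ht : 0 < t) (a : ℤ) (k : ℕ) :
    Real.exp (-2 * t) * ((Real.Gamma ((a : ℝ) + k + 1))⁻¹ / (k.factorial : ℝ)
      * (2 * t / 2) ^ (2 * (k : ℝ) + a)) =
    if ((a + k).toNat : ℤ) - (k : ℤ) = a then poisPair t ((a + k).toNat, k) else 0 := by
  rw [mul_div_cancel_left₀ t two_ne_zero]
  by_cases h : 0 ≤ a + k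
  · obtain ⟨x, hx⟩ := Int.eq_ofNat_of_zero_le h
    have hxr : (a : ℝ) + k = x := by exact_mod_cast hx
    have h2 : 2 * (k : ℝ) + a = ((x + k : ℕ) : ℝ) := by push_cast; linarith
    rw [hxr, h2, Real.rpow_natCast, Real.Gamma_nat_eq_factorial, hx, Int.toNat_natCast,
      if_pos (by omega)]
    have : Real.exp (-2 * t) = Real.exp (-t) * Real.exp (-t) := by
      rw [← Real.exp_add]; ring_nf
    rw [this, poisPair, pois, pois, pow_add]
    field_simp
  -- When `a + k < 0` the Bessel term vanishes because `Real.Gamma` is `0` at its poles, and `toNat`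
  -- truncates to `0`, so the condition fails as well.
  · rw [if_neg (by omega)]
    obtain ⟨x, hx⟩ := Int.eq_ofNat_of_zero_le (show 0 ≤ -(a + k + 1) by omega)
    have hxr : (a : ℝ) + k + 1 = -(x : ℝ) := by
      have : -((a : ℝ) + k + 1) = x := by exact_mod_cast hx
      linarith
    rw [hxr, Real.Gamma_neg_nat_eq_zero]
    simp

/-- The Bessel heat kernel is the law of the difference of two Poisson variables. -/
lemma hasSum_besselI {t : ℝ} (ht : 0 < t) (a : ℤ) :
    HasSum (fun z : ℕ × ℕ => if (z.1 : ℤ) - z.2 = a then poisPair t z else 0)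
      (Real.exp (-2 * t) * besselI a (2 * t)) := by
  set F : ℕ × ℕ → ℝ := fun z => if (z.1 : ℤ) - z.2 = a then poisPair t z else 0 with hF
  have hsum : Summable F := by
    refine Summable.of_nonneg_of_le (fun z => ?_) (fun z => ?_) (hasSum_poisPair ht.le).summable
    · simp only [hF]
      split_ifs
      exacts [poisPair_nonneg ht.le z, le_rfl]
    · simp only [hF]
      split_ifs
      exacts [le_rfl, poisPair_nonneg ht.le z]
  let g : ℕ → ℕ × ℕ := fun k => ((a + k).toNat, k)
  have hg : Function.Injective g := fun k l h => congrArg Prod.snd h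
  have hoff : ∀ z, z ∉ Set.range g → F z = 0 := by
    intro z hz
    simp only [hF]
    rw [if_neg]
    intro h
    refine hz ⟨z.2, Prod.ext ?_ rfl⟩
    change (a + (z.2 : ℤ)).toNat = z.1
    omega
  have h1 : HasSum (F ∘ g) (∑' z, F z) := (hg.hasSum_iff hoff).2 hsum.hasSum
  have h2 : Real.exp (-2 * t) * besselI a (2 * t) = ∑' z, F z := by
    rw [besselI, ← tsum_mul_left, ← h1.tsum_eq]
    exact tsum_congr fun k => besselI_term ht a k
  rw [h2]
  exact hsum.hasSum

lemma besselI_neg {t : ℝ} (ht : 0 < t) (a : ℤ) :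
    Real.exp (-2 * t) * besselI ((-a : ℤ) : ℝ) (2 * t)
      = Real.exp (-2 * t) * besselI (a : ℝ) (2 * t) := by
  refine HasSum.unique (hasSum_besselI ht (-a)) ?_
  have h := (Equiv.prodComm ℕ ℕ).hasSum_iff.2 (hasSum_besselI ht a)
  refine hasSum_of_eq h (fun z => ?_) rfl
  change (if (z.2 : ℤ) - z.1 = a then poisPair t z.swap else 0) = _
  by_cases h : (z.1 : ℤ) - z.2 = -a
  · rw [if_pos h, if_pos (by omega), poisPair, poisPair, mul_comm]; rfl
  · rw [if_neg h, if_neg (by omega)]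

/-! ### Tilting and pointwise heat kernel bounds -/

/-- Exponential change of measure: the Poisson law of mean `t` has an explicit density with respect
to the one of mean `t e^l`. -/
lemma pois_tilt (t l : ℝ) (k : ℕ) :
    pois t k = Real.exp (-l * k) * Real.exp (t * Real.exp l - t) * pois (t * Real.exp l) k := by
  have h1 : Real.exp (-l * k) * Real.exp l ^ k = 1 := by
    rw [← Real.exp_nat_mul, ← Real.exp_add]
    simp [mul_comm]
  have h2 : Real.exp (t * Real.exp l - t) * Real.exp (-(t * Real.exp l)) = Real.exp (-t) := by
    rw [← Real.exp_add]; ring_nf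
  unfold pois
  rw [mul_pow, ← h2]
  linear_combination -(Real.exp (t * Real.exp l - t) * Real.exp (-(t * Real.exp l)) * t ^ k
    / (k.factorial : ℝ)) * h1

lemma exp_add_exp_neg_le {l : ℝ} (h0 : 0 ≤ l) (h1 : l ≤ 1) :
    Real.exp l + Real.exp (-l) - 2 ≤ 2 * l ^ 2 := by
  have a1 := Real.abs_exp_sub_one_sub_id_le (x := l) (by rwa [abs_of_nonneg h0])
  have a2 := Real.abs_exp_sub_one_sub_id_le (x := -l) (by rwa [abs_neg, abs_of_nonneg h0])
  have := abs_le.1 a1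
  have := abs_le.1 a2
  nlinarith

/-- Chernoff bound: tilt `X` by `l = 1/s` and `Y` by `-l`. On `X - Y = a` the densities produce
`e^{-a/s}` at the cost `exp(t(e^l + e^{-l} - 2)) ≤ e²`, since `t ≤ s²`. The tilted weight of `X` is
bounded by `1/s`, and that of `Y` sums to one. The bound `hsup` is needed beyond `t` because tilting
raises the mean of `X`. -/
lemma besselI_le_of_nonneg {t s : ℝ} (ht : 0 < t) (hs1 : 1 ≤ s) (hts : t ≤ s ^ 2)
    (hsup : ∀ τ, t ≤ τ → ∀ k, pois τ k ≤ 1 / s) {a : ℤ} (ha : 0 ≤ a) :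
    Real.exp (-2 * t) * besselI (a : ℝ) (2 * t)
      ≤ Real.exp 2 * (1 / s) * Real.exp (-(a : ℝ) / s) := by
  have hs : 0 < s := by linarith
  set l := 1 / s with hl
  have hl0 : 0 < l := by positivity
  have hl1 : l ≤ 1 := by rw [hl, div_le_one hs]; exact hs1
  have htl : t * l ^ 2 ≤ 1 := by
    rw [hl, one_div, inv_pow, ← div_eq_mul_inv, div_le_one (by positivity)]; exact hts
  have hexp : t * Real.exp l - t + (t * Real.exp (-l) - t) ≤ 2 := by
    have := mul_le_mul_of_nonneg_left (exp_add_exp_neg_le hl0.le hl1) ht.le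
    nlinarith
  have hF := hasSum_besselI ht a
  let g : ℕ → ℕ × ℕ := fun k => ((a + k).toNat, k)
  have hg : Function.Injective g := fun k l h => congrArg Prod.snd h
  have h1 := (hg.hasSum_iff (f := fun z : ℕ × ℕ =>
      if (z.1 : ℤ) - z.2 = a then poisPair t z else 0) (by
    intro z hz
    rw [if_neg]
    intro h
    refine hz ⟨z.2, Prod.ext ?_ rfl⟩
    change (a + (z.2 : ℤ)).toNat = z.1
    omega)).2 hF
  have h2 := (hasSum_pois (t * Real.exp (-l))).mul_left (Real.exp 2 * l * Real.exp (-(a : ℝ) / s))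
  rw [mul_one] at h2
  refine hasSum_le (fun k => ?_) h1 h2
  simp only [Function.comp, g]
  obtain ⟨b, rfl⟩ := Int.eq_ofNat_of_zero_le ha
  have hb : ((b : ℤ) + (k : ℤ)).toNat = b + k := by omega
  rw [hb, if_pos (by push_cast; ring), poisPair, pois_tilt t l (b + k), pois_tilt t (-l) k]
  have hp := hsup (t * Real.exp l) (le_mul_of_one_le_right ht.le (Real.one_le_exp hl0.le)) (b + k)
  have hq := pois_nonneg (t := t * Real.exp (-l)) (by positivity) k
  calc _ = Real.exp (-(b : ℝ) / s) * Real.exp (t * Real.exp l - t + (t * Real.exp (-l) - t))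
        * (pois (t * Real.exp l) (b + k) * pois (t * Real.exp (-l)) k) := by
        rw [Real.exp_add (t * Real.exp l - t)]
        have : Real.exp (-(b : ℝ) / s)
            = Real.exp (-l * ((b + k : ℕ) : ℝ)) * Real.exp (- -l * (k : ℝ)) := by
          rw [← Real.exp_add]; congr 1; rw [hl]; push_cast; ring
        rw [this]; ring
    _ ≤ Real.exp (-(b : ℝ) / s) * Real.exp 2 * (l * pois (t * Real.exp (-l)) k) := by
        have := pois_nonneg (t := t * Real.exp l) (by positivity) (b + k)
        gcongr
    _ = _ := by push_cast; ring

lemma besselI_le {t s : ℝ} (ht : 0 < t) (hs1 : 1 ≤ s) (hts : t ≤ s ^ 2)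
    (hsup : ∀ τ, t ≤ τ → ∀ k, pois τ k ≤ 1 / s) (a : ℤ) :
    Real.exp (-2 * t) * besselI (a : ℝ) (2 * t)
      ≤ Real.exp 2 * (1 / s) * Real.exp (-|(a : ℝ)| / s) := by
  rcases le_total 0 a with ha | ha
  · rw [abs_of_nonneg (by exact_mod_cast ha)]
    exact besselI_le_of_nonneg ht hs1 hts hsup ha
  · have := besselI_le_of_nonneg ht hs1 hts hsup (a := -a) (by omega)
    rw [besselI_neg ht] at this
    rw [abs_of_nonpos (by exact_mod_cast ha)]
    push_cast at this
    exact this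

lemma besselI_nonneg {t : ℝ} (ht : 0 < t) (a : ℤ) :
    0 ≤ Real.exp (-2 * t) * besselI (a : ℝ) (2 * t) := by
  refine (hasSum_besselI ht a).nonneg fun z => ?_
  split_ifs
  exacts [poisPair_nonneg ht.le z, le_rfl]

lemma latticeNorm_nonneg {N : ℕ} (n : Fin N → ℤ) : 0 ≤ latticeNorm n :=
  Finset.sum_nonneg fun _ _ => abs_nonneg _

lemma heatKernel_nonneg {N : ℕ} {t : ℝ} (ht : 0 < t) (n : Fin N → ℤ) : 0 ≤ heatKernel t n :=
  Finset.prod_nonneg fun i _ => besselI_nonneg ht (n i)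

/-- Gaussian-type bound for the heat kernel at the scale `s = max 1 √t`. -/
lemma heatKernel_le_exp {N : ℕ} {t : ℝ} (ht : 0 < t) (n : Fin N → ℤ) :
    ∃ s : ℝ, 1 ≤ s ∧ t ≤ s ^ 2 ∧
      heatKernel t n ≤ Real.exp (2 * N) * (1 / s) ^ N * Real.exp (-latticeNorm n / s) := by
  obtain ⟨s, hs1, hts, hsup⟩ : ∃ s : ℝ, 1 ≤ s ∧ t ≤ s ^ 2 ∧
      ∀ τ, t ≤ τ → ∀ k, pois τ k ≤ 1 / s := by
    rcases le_total t 1 with h | h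
    · exact ⟨1, le_rfl, by simpa using h, fun τ hτ k => by
        simpa using pois_le_one (ht.le.trans hτ) k⟩
    · refine ⟨√t, Real.one_le_sqrt.2 h, (Real.sq_sqrt ht.le).ge, fun τ hτ k => ?_⟩
      exact pois_le_inv (Real.sqrt_pos.2 ht) (by rwa [Real.sq_sqrt ht.le]) k
  refine ⟨s, hs1, hts, ?_⟩
  calc heatKernel t n ≤ ∏ i : Fin N, Real.exp 2 * (1 / s) * Real.exp (-|(n i : ℝ)| / s) :=
        Finset.prod_le_prod (fun i _ => besselI_nonneg ht (n i))
          fun i _ => besselI_le ht hs1 hts hsup (n i)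
    _ = _ := by
        rw [Finset.prod_mul_distrib, Finset.prod_mul_distrib, ← Real.exp_sum, ← Real.exp_sum]
        simp only [Finset.prod_const, Finset.sum_const, Finset.card_univ, Fintype.card_fin]
        rw [nsmul_eq_mul, mul_comm (N : ℝ) 2, latticeNorm, ← Finset.sum_div,
          Finset.sum_neg_distrib]

lemma heatKernel_le_time {N : ℕ} {t : ℝ} (ht : 0 < t) (n : Fin N → ℤ) :
    heatKernel t n ≤ Real.exp (2 * N) * t ^ (-(N : ℝ) / 2) := by
  obtain ⟨s, hs1, hts, h⟩ := heatKernel_le_exp ht n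
  have hs : 0 < s := by linarith
  refine h.trans ?_
  have h1 : Real.exp (-latticeNorm n / s) ≤ 1 := by
    rw [Real.exp_le_one_iff]
    exact div_nonpos_of_nonpos_of_nonneg (by linarith [latticeNorm_nonneg n]) hs.le
  have h2 : (1 / s) ^ N ≤ t ^ (-(N : ℝ) / 2) := by
    have : (1 / s) ^ N = (s ^ 2) ^ (-(N : ℝ) / 2) := by
      rw [← Real.rpow_natCast s 2, ← Real.rpow_mul hs.le, one_div, inv_pow,
        ← Real.rpow_natCast, ← Real.rpow_neg hs.le]
      congr 1; push_cast; ring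
    rw [this]
    refine Real.rpow_le_rpow_of_nonpos ht hts ?_
    have : (0 : ℝ) ≤ N := Nat.cast_nonneg N
    linarith
  calc _ ≤ Real.exp (2 * N) * (1 / s) ^ N * 1 := by gcongr
    _ ≤ _ := by rw [mul_one]; gcongr

/-- Uniform in time: `e^{-|n|/s}` absorbs `((1+|n|)/s)^N` through `x^N / N! ≤ e^x`, at the cost of
one factor `e` as `s ≥ 1`. -/
lemma heatKernel_le_space {N : ℕ} {t : ℝ} (ht : 0 < t) (n : Fin N → ℤ) :
    heatKernel t n ≤ Real.exp (2 * N + 1) * (N.factorial : ℝ) * (1 + latticeNorm n) ^ (-(N : ℝ)) := by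
  obtain ⟨s, hs1, hts, h⟩ := heatKernel_le_exp ht n
  have hs : 0 < s := by linarith
  have hn := latticeNorm_nonneg n
  refine h.trans ?_
  rw [Real.rpow_neg (by linarith), Real.rpow_natCast, ← div_eq_mul_inv,
    le_div_iff₀ (by positivity)]
  have h1 := Real.pow_div_factorial_le_exp ((1 + latticeNorm n) / s) (by positivity) N
  rw [div_le_iff₀ (by positivity)] at h1
  have h2 : Real.exp (-latticeNorm n / s) * Real.exp ((1 + latticeNorm n) / s) ≤ Real.exp 1 := by
    rw [← Real.exp_add, Real.exp_le_exp, ← add_div, div_le_one hs]; linarith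
  calc _ = Real.exp (2 * N) * (Real.exp (-latticeNorm n / s) * ((1 + latticeNorm n) / s) ^ N) := by
        rw [div_pow, div_pow]; ring
    _ ≤ Real.exp (2 * N) * (Real.exp (-latticeNorm n / s)
          * (Real.exp ((1 + latticeNorm n) / s) * N.factorial)) := by gcongr
    _ ≤ Real.exp (2 * N) * (Real.exp 1 * N.factorial) := by rw [← mul_assoc (Real.exp _) _ (N.factorial : ℝ)]; gcongr
    _ = _ := by rw [Real.exp_add]; ring

end DiscreteLaplacian


/-! ### Absolute convergence of the semigroup and of the fractional integral -/

namespace DiscreteLaplacian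

lemma hasSum_pi_prod {κ : Type*} {N : ℕ} (f : Fin N → κ → ℝ) (hf : ∀ i k, 0 ≤ f i k)
    (a : Fin N → ℝ) (h : ∀ i, HasSum (f i) (a i)) :
    HasSum (fun ω : Fin N → κ => ∏ i, f i (ω i)) (∏ i, a i) := by
  induction N with
  | zero =>
    simp only [Finset.univ_eq_empty, Finset.prod_empty]
    exact hasSum_of_eq (hasSum_unique (fun _ : Fin 0 → κ => (1 : ℝ))) (fun _ => rfl) rfl
  | succ N ih =>
    have h0 := ih (fun i => f i.succ) (fun i => hf i.succ) (fun i => a i.succ) (fun i => h i.succ)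
    have hs := (h 0).summable.mul_of_nonneg h0.summable (fun k => hf 0 k)
      (fun ω => Finset.prod_nonneg fun i _ => hf i.succ _)
    have h1 := (h 0).mul h0 hs
    rw [← (Fin.consEquiv fun _ : Fin (N + 1) => κ).hasSum_iff]
    refine hasSum_of_eq h1 (fun z => ?_) ?_
    · simp [Fin.prod_univ_succ, Fin.consEquiv]
    · rw [Fin.prod_univ_succ]

/-- Kernel and semigroup are infinite sums, so their measurability in `t` comes from finite partial
sums. -/
lemma aestronglyMeasurable_of_hasSum {ι α E : Type*} [Countable ι] [MeasurableSpace α]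
    [NormedAddCommGroup E] {μ : Measure α} {F : ι → α → E} {g : α → E}
    (hF : ∀ i, AEStronglyMeasurable (F i) μ) (h : ∀ᵐ t ∂μ, HasSum (fun i => F i t) (g t)) :
    AEStronglyMeasurable g μ := by
  refine aestronglyMeasurable_of_tendsto_ae (Filter.atTop : Filter (Finset ι))
    (f := fun s t => ∑ i ∈ s, F i t)
    (fun s => Finset.aestronglyMeasurable_fun_sum s fun i _ => hF i) ?_
  filter_upwards [h] with t ht
  exact ht

lemma continuous_pois (k : ℕ) : Continuous fun t : ℝ => pois t k := by
  unfold pois; fun_prop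

lemma aestronglyMeasurable_heatKernel {N : ℕ} (n : Fin N → ℤ) :
    AEStronglyMeasurable (fun t : ℝ => heatKernel t n) (volume.restrict (Set.Ioi 0)) := by
  unfold heatKernel
  refine Finset.aestronglyMeasurable_fun_prod _ fun i _ => ?_
  refine aestronglyMeasurable_of_hasSum (ι := ℕ × ℕ)
    (F := fun z t => if (z.1 : ℤ) - z.2 = n i then poisPair t z else 0) (fun z => ?_) ?_
  · refine Continuous.aestronglyMeasurable ?_
    split_ifs
    · exact (continuous_pois _).mul (continuous_pois _)
    · exact continuous_const
  · filter_upwards [ae_restrict_mem measurableSet_Ioi] with t ht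
    exact hasSum_besselI ht (n i)

section PowerBounds

variable {E : Type*} [NormedAddCommGroup E] [NormedSpace ℝ E]

/-- A function dominated by different powers on both sides of `T` is integrable. -/
lemma integrableOn_and_norm_integral_le {g : ℝ → E}
    (hg : AEStronglyMeasurable g (volume.restrict (Set.Ioi 0))) {T B₁ B₂ p q : ℝ} (hT : 0 < T)
    (hp : -1 < p) (hq : q < -1) (h₁ : ∀ t, 0 < t → t ≤ T → ‖g t‖ ≤ B₁ * t ^ p)
    (h₂ : ∀ t, T < t → ‖g t‖ ≤ B₂ * t ^ q) :
    IntegrableOn g (Set.Ioi 0) ∧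
      ‖∫ t in Set.Ioi 0, g t‖ ≤
        B₁ * (T ^ (p + 1) / (p + 1)) + B₂ * (T ^ (q + 1) / (-(q + 1))) := by
  have hsplit : Set.Ioi (0 : ℝ) = Set.Ioc 0 T ∪ Set.Ioi T :=
    (Set.Ioc_union_Ioi_eq_Ioi hT.le).symm
  have i₁ : IntegrableOn (fun t : ℝ => B₁ * t ^ p) (Set.Ioc 0 T) := by
    have := (intervalIntegral.intervalIntegrable_rpow' (a := 0) (b := T) hp).const_mul B₁
    rwa [intervalIntegrable_iff_integrableOn_Ioc_of_le hT.le] at this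
  have i₂ : IntegrableOn (fun t : ℝ => B₂ * t ^ q) (Set.Ioi T) :=
    (integrableOn_Ioi_rpow_of_lt hq hT).const_mul B₂
  have a₁ : ∀ᵐ t ∂volume.restrict (Set.Ioc 0 T), ‖g t‖ ≤ B₁ * t ^ p := by
    filter_upwards [ae_restrict_mem measurableSet_Ioc] with t ht
    exact h₁ t ht.1 ht.2
  have a₂ : ∀ᵐ t ∂volume.restrict (Set.Ioi T), ‖g t‖ ≤ B₂ * t ^ q := by
    filter_upwards [ae_restrict_mem measurableSet_Ioi] with t ht
    exact h₂ t ht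
  have g₁ : IntegrableOn g (Set.Ioc 0 T) := Integrable.mono' i₁
    (hg.mono_measure (Measure.restrict_mono (by rw [hsplit]; exact Set.subset_union_left) le_rfl)) a₁
  have g₂ : IntegrableOn g (Set.Ioi T) := Integrable.mono' i₂
    (hg.mono_measure (Measure.restrict_mono (by rw [hsplit]; exact Set.subset_union_right) le_rfl)) a₂
  have e₁ : ∫ t in Set.Ioc 0 T, B₁ * t ^ p = B₁ * (T ^ (p + 1) / (p + 1)) := by
    rw [integral_const_mul, ← intervalIntegral.integral_of_le hT.le, integral_rpow (Or.inl hp),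
      Real.zero_rpow (by linarith), sub_zero]
  have e₂ : ∫ t in Set.Ioi T, B₂ * t ^ q = B₂ * (T ^ (q + 1) / (-(q + 1))) := by
    rw [integral_const_mul, integral_Ioi_rpow_of_lt hq hT, neg_div, div_neg]
  refine ⟨by rw [hsplit]; exact g₁.union g₂, ?_⟩
  rw [hsplit, setIntegral_union (Set.Ioc_disjoint_Ioi le_rfl) measurableSet_Ioi g₁ g₂]
  refine (norm_add_le _ _).trans (add_le_add ?_ ?_)
  · exact (norm_integral_le_of_norm_le i₁ a₁).trans e₁.le
  · exact (norm_integral_le_of_norm_le i₂ a₂).trans e₂.le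

end PowerBounds

lemma aestronglyMeasurable_rpow (p : ℝ) :
    AEStronglyMeasurable (fun t : ℝ => t ^ p) (volume.restrict (Set.Ioi 0)) := by
  fun_prop

/-- Size of the kernel of the fractional integral. -/
lemma exists_integral_heatKernel_le {N : ℕ} {σ : ℝ} (hσ0 : 0 < σ) (hσN : 2 * σ < N) :
    ∃ C : ℝ, ∀ n : Fin N → ℤ,
      IntegrableOn (fun t : ℝ => t ^ (σ - 1) * heatKernel t n) (Set.Ioi 0) ∧
      ∫ t in Set.Ioi 0, t ^ (σ - 1) * heatKernel t n ≤ C * (1 + latticeNorm n) ^ (2 * σ - N) := by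
  set A := Real.exp (2 * N + 1) * (N.factorial : ℝ) with hA
  set B := Real.exp (2 * N) with hB
  refine ⟨A / σ + B / (N / 2 - σ), fun n => ?_⟩
  have hr : 0 < 1 + latticeNorm n := by linarith [latticeNorm_nonneg n]
  set r := 1 + latticeNorm n with hrdef
  -- The split `T = r²` is the diffusive time for distance `r`: the space bound is used before it,
  -- the time bound after it. The tail converges because `σ < N/2`.
  have key := integrableOn_and_norm_integral_le
    (g := fun t : ℝ => t ^ (σ - 1) * heatKernel t n) (T := r ^ 2) (B₁ := A * r ^ (-(N : ℝ)))
    (B₂ := B) (p := σ - 1) (q := σ - 1 - N / 2)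
    ((aestronglyMeasurable_rpow _).mul (aestronglyMeasurable_heatKernel n)) (by positivity)
    (by linarith) (by linarith) (fun t ht _ => ?_) (fun t ht => ?_)
  · refine ⟨key.1, (le_abs_self _).trans (key.2.trans (le_of_eq ?_))⟩
    have e1 : (r ^ 2) ^ (σ - 1 + 1) = r ^ (2 * σ) := by
      rw [← Real.rpow_natCast r 2, ← Real.rpow_mul hr.le]; congr 1; push_cast; ring
    have e2 : (r ^ 2) ^ (σ - 1 - N / 2 + 1) = r ^ (2 * σ - N) := by
      rw [← Real.rpow_natCast r 2, ← Real.rpow_mul hr.le]; congr 1; push_cast; ring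
    have e3 : r ^ (2 * σ - N) = r ^ (-(N : ℝ)) * r ^ (2 * σ) := by
      rw [← Real.rpow_add hr]; congr 1; ring
    rw [e1, e2, add_mul, show -(σ - 1 - (N : ℝ) / 2 + 1) = N / 2 - σ by ring]
    nth_rewrite 2 [e3]
    rw [show σ - 1 + 1 = σ by ring]
    ring
  · have h0 := heatKernel_nonneg ht n
    have h1 := heatKernel_le_space ht n
    have h2 : 0 < t ^ (σ - 1) := Real.rpow_pos_of_pos ht _
    rw [Real.norm_of_nonneg (by positivity), mul_comm]
    gcongr
  · have ht0 : 0 < t := lt_trans (by positivity) ht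
    have h0 := heatKernel_nonneg ht0 n
    have h1 := heatKernel_le_time ht0 n
    have h2 : 0 < t ^ (σ - 1) := Real.rpow_pos_of_pos ht0 _
    rw [Real.norm_of_nonneg (by positivity)]
    have h3 : t ^ (σ - 1 - (N : ℝ) / 2) = t ^ (σ - 1) * t ^ (-(N : ℝ) / 2) := by
      rw [← Real.rpow_add ht0]; congr 1; ring
    rw [h3]
    calc _ ≤ t ^ (σ - 1) * (B * t ^ (-(N : ℝ) / 2)) := by gcongr
      _ = _ := by ring

lemma latticeNorm_add_le {N : ℕ} (n m : Fin N → ℤ) :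
    latticeNorm (n + m) ≤ latticeNorm n + latticeNorm m := by
  unfold latticeNorm
  rw [← Finset.sum_add_distrib]
  refine Finset.sum_le_sum fun i _ => ?_
  simp only [Pi.add_apply, Int.cast_add]
  exact abs_add_le _ _

/-- Peetre's inequality, from `1+|k| ≤ (1+|n|)(1+|n-k|)`; it makes `ℓ_σ` translation invariant. -/
lemma weight_sub_le {N : ℕ} {s : ℝ} (hs : s ≤ 0) (n k : Fin N → ℤ) :
    (1 + latticeNorm (n - k)) ^ s ≤ (1 + latticeNorm n) ^ (-s) * (1 + latticeNorm k) ^ s := by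
  have h1 := latticeNorm_nonneg n
  have h2 := latticeNorm_nonneg k
  have h3 := latticeNorm_nonneg (n - k)
  have hneg : latticeNorm (-(n - k)) = latticeNorm (n - k) := by
    simp only [latticeNorm, Pi.neg_apply, Int.cast_neg, abs_neg]
  have htri : latticeNorm k ≤ latticeNorm n + latticeNorm (n - k) := by
    have := latticeNorm_add_le n (-(n - k))
    rw [hneg] at this
    simpa using this
  have hle : (1 + latticeNorm k) / (1 + latticeNorm n) ≤ 1 + latticeNorm (n - k) := by
    rw [div_le_iff₀ (by linarith)]
    nlinarith
  calc _ ≤ ((1 + latticeNorm k) / (1 + latticeNorm n)) ^ s :=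
        Real.rpow_le_rpow_of_nonpos (by positivity) hle hs
    _ = _ := by
        rw [Real.div_rpow (by linarith) (by linarith), Real.rpow_neg (by linarith)]
        ring

section FracIntegral

variable {N : ℕ} {E : Type*} [NormedAddCommGroup E]

lemma MemEll.summable_sub {σ : ℝ} (hσN : 2 * σ < N) {f : (Fin N → ℤ) → E} (hf : MemEll σ f)
    (n : Fin N → ℤ) : Summable fun k => (1 + latticeNorm (n - k)) ^ (2 * σ - N) * ‖f k‖ := by
  refine Summable.of_nonneg_of_le (fun k => ?_) (fun k => ?_)
    (hf.mul_left ((1 + latticeNorm n) ^ (-(2 * σ - N))))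
  · have := latticeNorm_nonneg (n - k)
    positivity
  · calc _ ≤ (1 + latticeNorm n) ^ (-(2 * σ - N)) * (1 + latticeNorm k) ^ (2 * σ - N) * ‖f k‖ := by
          gcongr
          exact weight_sub_le (by linarith) n k
      _ = _ := by ring

lemma MemEll.comp_add {σ : ℝ} (hσN : 2 * σ < N) {f : (Fin N → ℤ) → E} (hf : MemEll σ f)
    (e : Fin N → ℤ) : MemEll σ fun n => f (n + e) := by
  have h := (Equiv.addRight e).summable_iff.2 (hf.summable_sub hσN e)
  refine h.congr fun k => ?_
  have h1 : latticeNorm (e - (k + e)) = latticeNorm k := by simp [latticeNorm]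
  simp only [Function.comp, Equiv.coe_addRight, h1]
  ring

lemma MemEll.sub {σ : ℝ} {f g : (Fin N → ℤ) → E} (hf : MemEll σ f) (hg : MemEll σ g) :
    MemEll σ fun n => f n - g n := by
  refine Summable.of_nonneg_of_le (fun k => ?_) (fun k => ?_) (Summable.add hf hg)
  · have := latticeNorm_nonneg k
    positivity
  · have := latticeNorm_nonneg k
    rw [← add_mul]
    gcongr
    exact norm_sub_le _ _

lemma MemEll.summable_heatKernel_mul_norm {σ : ℝ} (hσ0 : 0 < σ) (hσN : 2 * σ < N)
    {f : (Fin N → ℤ) → E} (hf : MemEll σ f) (n : Fin N → ℤ) {t : ℝ} (ht : 0 < t) :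
    Summable fun k => heatKernel t (n - k) * ‖f k‖ := by
  refine Summable.of_nonneg_of_le (fun k => ?_) (fun k => ?_)
    ((hf.summable_sub hσN n).mul_left (Real.exp (2 * N + 1) * (N.factorial : ℝ)))
  · exact mul_nonneg (heatKernel_nonneg ht _) (norm_nonneg _)
  · rw [← mul_assoc]
    refine mul_le_mul_of_nonneg_right ((heatKernel_le_space ht _).trans ?_) (norm_nonneg _)
    gcongr
    · linarith [latticeNorm_nonneg (n - k)]
    · linarith

variable [NormedSpace ℝ E] [CompleteSpace E]

lemma MemEll.summable_heatKernel_smul {σ : ℝ} (hσ0 : 0 < σ) (hσN : 2 * σ < N)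
    {f : (Fin N → ℤ) → E} (hf : MemEll σ f) (n : Fin N → ℤ) {t : ℝ} (ht : 0 < t) :
    Summable fun k => heatKernel t (n - k) • f k := by
  refine Summable.of_norm ((hf.summable_heatKernel_mul_norm hσ0 hσN n ht).congr fun k => ?_)
  rw [norm_smul, Real.norm_of_nonneg (heatKernel_nonneg ht _)]

/-- Tonelli: the time integrals of the kernel are dominated by the translated `ℓ_σ` weight, so the
double sum-integral of norms is finite. -/
lemma MemEll.integrableOn_heatSemigroup {σ : ℝ} (hσ0 : 0 < σ) (hσN : 2 * σ < N)
    {f : (Fin N → ℤ) → E} (hf : MemEll σ f) (n : Fin N → ℤ) :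
    IntegrableOn (fun t : ℝ => t ^ (σ - 1) • heatSemigroup t f n) (Set.Ioi 0) := by
  obtain ⟨C, hC⟩ := exists_integral_heatKernel_le (N := N) hσ0 hσN
  set F : (Fin N → ℤ) → ℝ → E := fun k t => (t ^ (σ - 1) * heatKernel t (n - k)) • f k with hF
  have hFi : ∀ k, Integrable (F k) (volume.restrict (Set.Ioi 0)) := fun k =>
    (hC (n - k)).1.smul_const (f k)
  have hnorm : ∀ k, ∫ t in Set.Ioi 0, ‖F k t‖
      = (∫ t in Set.Ioi 0, t ^ (σ - 1) * heatKernel t (n - k)) * ‖f k‖ := by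
    intro k
    rw [← integral_mul_const]
    refine setIntegral_congr_fun measurableSet_Ioi fun t (ht : 0 < t) => ?_
    have := heatKernel_nonneg ht (n - k)
    have := Real.rpow_pos_of_pos ht (σ - 1)
    simp only [hF]
    rw [norm_smul, Real.norm_of_nonneg (by positivity)]
  have hsum : Summable fun k => ∫ t in Set.Ioi 0, ‖F k t‖ := by
    refine Summable.of_nonneg_of_le (fun k => integral_nonneg fun t => norm_nonneg _) (fun k => ?_)
      ((hf.summable_sub hσN n).mul_left C)
    rw [hnorm, ← mul_assoc]
    exact mul_le_mul_of_nonneg_right (hC (n - k)).2 (norm_nonneg _)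
  have hW : ∀ t : ℝ, 0 < t → HasSum (fun k => F k t) (t ^ (σ - 1) • heatSemigroup t f n) := by
    intro t ht
    have := (hf.summable_heatKernel_smul hσ0 hσN n ht).hasSum.const_smul (t ^ (σ - 1))
    exact hasSum_of_eq this (fun k => by simp only [hF, mul_smul]) rfl
  refine ⟨aestronglyMeasurable_of_hasSum (fun k => (hFi k).1) ?_, ?_⟩
  · filter_upwards [ae_restrict_mem measurableSet_Ioi] with t ht
    exact hW t ht
  · refine lt_of_le_of_lt (b := ∫⁻ t in Set.Ioi (0 : ℝ), ∑' k, ‖F k t‖ₑ) ?_ ?_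
    · refine setLIntegral_mono_ae' measurableSet_Ioi (Filter.Eventually.of_forall fun t ht => ?_)
      beta_reduce
      rw [← (hW t ht).tsum_eq]
      exact enorm_tsum_le_tsum_enorm
    · rw [lintegral_tsum fun k => (hFi k).1.enorm]
      simp_rw [← ofReal_integral_norm_eq_lintegral_enorm (hFi _)]
      exact lt_top_iff_ne_top.2 hsum.tsum_ofReal_ne_top

end FracIntegral

end DiscreteLaplacian


namespace DiscreteLaplacian

/-! ### The heat semigroup as an expectation over Poisson variables -/

/-- The weight of a configuration of `2N` independent Poisson variables. -/
noncomputable def poisWeight {N : ℕ} (t : ℝ) (ω : Fin N → ℕ × ℕ) : ℝ := ∏ i, poisPair t (ω i)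

/-- The displacement of a configuration. -/
def disp {N : ℕ} (ω : Fin N → ℕ × ℕ) : Fin N → ℤ := fun i => ((ω i).1 : ℤ) - (ω i).2

lemma poisWeight_nonneg {N : ℕ} {t : ℝ} (ht : 0 < t) (ω : Fin N → ℕ × ℕ) : 0 ≤ poisWeight t ω :=
  Finset.prod_nonneg fun _ _ => poisPair_nonneg ht.le _

lemma hasSum_poisWeight {N : ℕ} {t : ℝ} (ht : 0 < t) :
    HasSum (poisWeight t : (Fin N → ℕ × ℕ) → ℝ) 1 :=
  hasSum_of_eq (hasSum_pi_prod (fun _ => poisPair t) (fun _ => poisPair_nonneg ht.le) (fun _ => 1)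
    fun _ => hasSum_poisPair ht.le) (fun _ => rfl) (by simp)

lemma hasSum_heatKernel {N : ℕ} {t : ℝ} (ht : 0 < t) (n : Fin N → ℤ) :
    HasSum (fun ω : Fin N → ℕ × ℕ => if disp ω = n then poisWeight t ω else 0)
      (heatKernel t n) := by
  refine hasSum_of_eq (hasSum_pi_prod
    (fun i (z : ℕ × ℕ) => if (z.1 : ℤ) - z.2 = n i then poisPair t z else 0) (fun i z => ?_) _
    fun i => hasSum_besselI ht (n i)) (fun ω => ?_) rfl
  · split_ifs
    exacts [poisPair_nonneg ht.le z, le_rfl]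
  · rw [Finset.prod_ite_zero]
    simp only [Finset.mem_univ, true_implies, funext_iff, disp, poisWeight]

section Semigroup

variable {N : ℕ} {E : Type*} [NormedAddCommGroup E] [NormedSpace ℝ E] [CompleteSpace E]

/-- `W_t f(n)` is the expectation of `f(n - X + Y)` for independent Poisson vectors `X`, `Y`. -/
lemma MemEll.hasSum_heatSemigroup {σ : ℝ} (hσ0 : 0 < σ) (hσN : 2 * σ < N)
    {f : (Fin N → ℤ) → E} (hf : MemEll σ f) (n : Fin N → ℤ) {t : ℝ} (ht : 0 < t) :
    HasSum (fun ω => poisWeight t ω • f (n - disp ω)) (heatSemigroup t f n) := by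
  let G : (Fin N → ℤ) × (Fin N → ℕ × ℕ) → E := fun z =>
    (if disp z.2 = n - z.1 then poisWeight t z.2 else 0) • f z.1
  have hnorm : ∀ z, ‖G z‖ = (if disp z.2 = n - z.1 then poisWeight t z.2 else 0) * ‖f z.1‖ := by
    intro z
    simp only [G]
    rw [norm_smul, Real.norm_of_nonneg]
    split_ifs
    exacts [poisWeight_nonneg ht _, le_rfl]
  have hG : Summable G := by
    refine Summable.of_norm ((summable_prod_of_nonneg fun z => norm_nonneg _).2 ?_)
    simp only [hnorm]
    refine ⟨fun k => ((hasSum_heatKernel ht (n - k)).mul_right ‖f k‖).summable, ?_⟩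
    exact (hf.summable_heatKernel_mul_norm hσ0 hσN n ht).congr fun k =>
      ((hasSum_heatKernel ht (n - k)).mul_right ‖f k‖).tsum_eq.symm
  have h1 : HasSum (fun k => heatKernel t (n - k) • f k) (∑' z, G z) :=
    hG.hasSum.prod_fiberwise fun k => (hasSum_heatKernel ht (n - k)).smul_const (f k)
  rw [heatSemigroup, h1.tsum_eq]
  have h2 := (Equiv.prodComm (Fin N → ℕ × ℕ) (Fin N → ℤ)).hasSum_iff.2 hG.hasSum
  refine h2.prod_fiberwise fun ω => ?_
  refine hasSum_of_eq (hasSum_single (n - disp ω) fun k hk => ?_) (fun _ => rfl) ?_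
  · change (if disp ω = n - k then poisWeight t ω else 0) • f k = 0
    rw [if_neg, zero_smul]
    rintro h
    exact hk (by rw [h]; simp)
  · change (if disp ω = n - (n - disp ω) then poisWeight t ω else 0) • f (n - disp ω) = _
    rw [if_pos (by simp)]

end Semigroup

/-- The unit vectors of `ℕ × ℕ`. -/
def unitPair (b : Bool) : ℕ × ℕ := if b then (1, 0) else (0, 1)

/-- The coordinates of `ℕ × ℕ`. -/
def coordPair (b : Bool) (z : ℕ × ℕ) : ℕ := if b then z.1 else z.2

/-- The normalized deviation `X_i / t - 1` or `Y_i / t - 1`. -/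
noncomputable def dev {N : ℕ} (t : ℝ) (b : Bool) (i : Fin N) (ω : Fin N → ℕ × ℕ) : ℝ :=
  coordPair b (ω i) / t - 1

/-- The configuration with one more particle of type `b` at `i`. -/
def addParticle {N : ℕ} (b : Bool) (i : Fin N) (ω : Fin N → ℕ × ℕ) : Fin N → ℕ × ℕ :=
  Function.update ω i (ω i + unitPair b)

lemma poisPair_add_unit (t : ℝ) (b : Bool) (z : ℕ × ℕ) :
    poisPair t (z + unitPair b) * (coordPair b z + 1) = t * poisPair t z := by
  cases b
  · have := pois_succ_mul t z.2
    simp only [unitPair, coordPair, poisPair, Bool.false_eq_true, if_false, Prod.fst_add,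
      Prod.snd_add, add_zero]
    linear_combination pois t z.1 * this
  · have := pois_succ_mul t z.1
    simp only [unitPair, coordPair, poisPair, if_true, Prod.fst_add, Prod.snd_add, add_zero]
    linear_combination pois t z.2 * this

lemma coordPair_add_unit (b : Bool) (z : ℕ × ℕ) :
    coordPair b (z + unitPair b) = coordPair b z + 1 := by
  cases b <;> simp [coordPair, unitPair]

lemma coordPair_add_unit_of_ne {b c : Bool} (h : b ≠ c) (z : ℕ × ℕ) :
    coordPair b (z + unitPair c) = coordPair b z := by
  cases b <;> cases c <;> simp_all [coordPair, unitPair]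

lemma exists_add_unit {b : Bool} {z : ℕ × ℕ} (h : coordPair b z ≠ 0) :
    ∃ w, w + unitPair b = z := by
  cases b
  · refine ⟨(z.1, z.2 - 1), Prod.ext ?_ ?_⟩ <;> simp_all [coordPair, unitPair]
    omega
  · refine ⟨(z.1 - 1, z.2), Prod.ext ?_ ?_⟩ <;> simp_all [coordPair, unitPair]
    omega

lemma dev_addParticle {N : ℕ} (t : ℝ) (b : Bool) (i : Fin N) (ω : Fin N → ℕ × ℕ) :
    dev t b i (addParticle b i ω) = dev t b i ω + 1 / t := by
  simp only [dev, addParticle, Function.update_self, coordPair_add_unit]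
  push_cast
  ring

lemma dev_addParticle_of_ne {N : ℕ} (t : ℝ) {b c : Bool} (h : b ≠ c) (i j : Fin N)
    (ω : Fin N → ℕ × ℕ) : dev t b i (addParticle c j ω) = dev t b i ω := by
  by_cases hij : i = j
  · subst hij
    simp only [dev, addParticle, Function.update_self, coordPair_add_unit_of_ne h]
  · simp only [dev, addParticle, Function.update_of_ne hij]

lemma poisWeight_addParticle {N : ℕ} (t : ℝ) (b : Bool) (i : Fin N) (ω : Fin N → ℕ × ℕ) :
    poisWeight t (addParticle b i ω) * (coordPair b (ω i) + 1) = t * poisWeight t ω := by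
  unfold poisWeight
  rw [← Finset.mul_prod_erase _ _ (Finset.mem_univ i),
    ← Finset.mul_prod_erase _ (fun j => poisPair t (ω j)) (Finset.mem_univ i)]
  have h1 : ∏ j ∈ Finset.univ.erase i, poisPair t (addParticle b i ω j)
      = ∏ j ∈ Finset.univ.erase i, poisPair t (ω j) := by
    refine Finset.prod_congr rfl fun j hj => ?_
    rw [addParticle, Function.update_of_ne (Finset.ne_of_mem_erase hj)]
  have h2 := poisPair_add_unit t b (ω i)
  rw [h1, addParticle, Function.update_self]
  linear_combination (∏ j ∈ Finset.univ.erase i, poisPair t (ω j)) * h2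

lemma addParticle_injective {N : ℕ} (b : Bool) (i : Fin N) :
    Function.Injective (addParticle b i) := by
  intro ω η h
  funext j
  have hj := congrFun h j
  by_cases hij : j = i
  · subst hij
    simpa [addParticle] using hj
  · simpa [addParticle, Function.update_of_ne hij] using hj

lemma disp_addParticle_true {N : ℕ} (i : Fin N) (ω : Fin N → ℕ × ℕ) :
    disp (addParticle true i ω) = disp ω + Pi.single i 1 := by
  funext j
  by_cases hij : j = i
  · subst hij
    simp [disp, addParticle, unitPair]
    ring
  · simp [disp, addParticle, Function.update_of_ne hij, Pi.single_eq_of_ne hij]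

lemma disp_addParticle_false {N : ℕ} (i : Fin N) (ω : Fin N → ℕ × ℕ) :
    disp (addParticle false i ω) = disp ω - Pi.single i 1 := by
  funext j
  by_cases hij : j = i
  · subst hij
    simp [disp, addParticle, unitPair]
    ring
  · simp [disp, addParticle, Function.update_of_ne hij, Pi.single_eq_of_ne hij]

/-- Stein's identity for the Poisson law: `E[(X_i/t - 1) h] = E[h(· + 1_i)] - E[h]`. -/
lemma hasSum_dev_smul {N : ℕ} {E : Type*} [NormedAddCommGroup E] [NormedSpace ℝ E] {t : ℝ}
    (ht : 0 < t) (b : Bool) (i : Fin N) {h : (Fin N → ℕ × ℕ) → E} {x y : E}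
    (hx : HasSum (fun ω => poisWeight t ω • h (addParticle b i ω)) x)
    (hy : HasSum (fun ω => poisWeight t ω • h ω) y) :
    HasSum (fun ω => (poisWeight t ω * dev t b i ω) • h ω) (x - y) := by
  -- Adding a particle reindexes the sum onto configurations with nonzero coordinate; on the others
  -- the factor `coordPair b (ω i)` vanishes.
  have key : HasSum (fun ω => (poisWeight t ω * (coordPair b (ω i) / t)) • h ω) x := by
    refine ((addParticle_injective b i).hasSum_iff fun ω hω => ?_).1
      (hasSum_of_eq hx (fun ω => ?_) rfl)
    · have : coordPair b (ω i) = 0 := by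
        by_contra hne
        obtain ⟨w, hw⟩ := exists_add_unit hne
        refine hω ⟨Function.update ω i w, ?_⟩
        simp [addParticle, hw]
      simp [this]
    · simp only [Function.comp]
      congr 1
      have := poisWeight_addParticle t b i ω
      rw [addParticle] at this ⊢
      rw [Function.update_self, coordPair_add_unit]
      push_cast
      field_simp
      linear_combination -this
  refine hasSum_of_eq (key.sub hy) (fun ω => ?_) rfl
  rw [← sub_smul, dev]
  congr 1
  ring

/-! ### Second moments of the deviations and of the displacement -/

section Moments

variable {N : ℕ} {t : ℝ}

lemma hasSum_dev_mul (ht : 0 < t) (b : Bool) (i : Fin N) {h : (Fin N → ℕ × ℕ) → ℝ} {x y : ℝ}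
    (hx : HasSum (fun ω => poisWeight t ω * h (addParticle b i ω)) x)
    (hy : HasSum (fun ω => poisWeight t ω * h ω) y) :
    HasSum (fun ω => poisWeight t ω * (dev t b i ω * h ω)) (x - y) :=
  hasSum_of_eq (hasSum_dev_smul ht b i hx hy) (fun ω => by rw [smul_eq_mul, mul_assoc]) rfl

lemma hasSum_dev (ht : 0 < t) (b : Bool) (i : Fin N) :
    HasSum (fun ω => poisWeight t ω * dev t b i ω) 0 := by
  have h : HasSum (fun ω : Fin N → ℕ × ℕ => poisWeight t ω * 1) 1 :=
    hasSum_of_eq (hasSum_poisWeight ht) (fun ω => (mul_one _).symm) rfl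
  exact hasSum_of_eq (hasSum_dev_mul ht b i (h := fun _ => 1) h h) (fun ω => by rw [mul_one])
    (sub_self _)

lemma hasSum_dev_sq (ht : 0 < t) (b : Bool) (i : Fin N) :
    HasSum (fun ω => poisWeight t ω * dev t b i ω ^ 2) (1 / t) := by
  have h0 := hasSum_dev ht b i
  have h1 : HasSum (fun ω => poisWeight t ω * dev t b i (addParticle b i ω)) (0 + 1 * (1 / t)) :=
    hasSum_of_eq (h0.add ((hasSum_poisWeight ht).mul_right (1 / t)))
      (fun ω => by rw [dev_addParticle]; ring) rfl
  exact hasSum_of_eq (hasSum_dev_mul ht b i h1 h0) (fun ω => by ring) (by ring)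

lemma hasSum_dev_mul_dev (ht : 0 < t) {b c : Bool} (hbc : b ≠ c) (i j : Fin N) :
    HasSum (fun ω => poisWeight t ω * (dev t b i ω * dev t c j ω)) 0 := by
  have h0 := hasSum_dev ht c j
  refine hasSum_of_eq (hasSum_dev_mul ht b i (h := dev t c j) (x := 0)
    (hasSum_of_eq h0 (fun ω => ?_) rfl) h0) (fun ω => rfl) (sub_self _)
  rw [dev_addParticle_of_ne t hbc.symm]

/-- Deviations of different types `b ≠ c` do not see each other's particles, so the second moment
factors as `(1/t)(1/t)`, even when `i = j`. -/
lemma hasSum_dev_sq_mul_dev_sq (ht : 0 < t) {b c : Bool} (hbc : b ≠ c) (i j : Fin N) :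
    HasSum (fun ω => poisWeight t ω * (dev t b i ω * dev t c j ω) ^ 2) (1 / t ^ 2) := by
  have h0 := hasSum_dev_sq ht c j
  have h1 : HasSum (fun ω => poisWeight t ω * (dev t b i ω * dev t c j ω ^ 2)) 0 := by
    refine hasSum_of_eq (hasSum_dev_mul ht b i (h := fun ω => dev t c j ω ^ 2) (x := 1 / t)
      (hasSum_of_eq h0 (fun ω => ?_) rfl) h0) (fun ω => rfl) (sub_self _)
    rw [dev_addParticle_of_ne t hbc.symm]
  refine hasSum_of_eq (hasSum_dev_mul ht b i (h := fun ω => dev t b i ω * dev t c j ω ^ 2)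
    (x := 0 + 1 / t * (1 / t)) (hasSum_of_eq (h1.add (h0.mul_right (1 / t))) (fun ω => ?_) rfl) h1)
    (fun ω => by ring) (by ring)
  rw [dev_addParticle_of_ne t hbc.symm, dev_addParticle]
  ring

/-- The sum of all squared deviations. -/
noncomputable def devSq (t : ℝ) (ω : Fin N → ℕ × ℕ) : ℝ :=
  ∑ i, (dev t true i ω ^ 2 + dev t false i ω ^ 2)

lemma hasSum_devSq (ht : 0 < t) :
    HasSum (fun ω : Fin N → ℕ × ℕ => poisWeight t ω * devSq t ω) (2 * N / t) := by
  have h := hasSum_sum (s := (Finset.univ : Finset (Fin N)))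
    fun i _ => (hasSum_dev_sq ht true i).add (hasSum_dev_sq ht false i)
  refine hasSum_of_eq h (fun ω => ?_) ?_
  · rw [devSq, Finset.mul_sum]
    exact Finset.sum_congr rfl fun i _ => by ring
  · simp only [Finset.sum_const, Finset.card_univ, Fintype.card_fin, nsmul_eq_mul]
    ring

lemma latticeNorm_disp_sq_le (ht : 0 < t) (ω : Fin N → ℕ × ℕ) :
    latticeNorm (disp ω) ^ 2 / t ≤ 2 * N * t * devSq t ω := by
  have h1 : latticeNorm (disp ω) ^ 2 ≤ N * ∑ i, (disp ω i : ℝ) ^ 2 := by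
    have := sq_sum_le_card_mul_sum_sq (s := (Finset.univ : Finset (Fin N)))
      (f := fun i => |(disp ω i : ℝ)|)
    simpa [latticeNorm, sq_abs] using this
  have h2 : ∀ i, (disp ω i : ℝ) ^ 2 ≤ 2 * t ^ 2 * (dev t true i ω ^ 2 + dev t false i ω ^ 2) := by
    intro i
    have : (disp ω i : ℝ) = t * (dev t true i ω - dev t false i ω) := by
      simp only [disp, dev, coordPair]
      push_cast
      field_simp
      simp
    rw [this]
    nlinarith [mul_nonneg (sq_nonneg t) (sq_nonneg (dev t true i ω + dev t false i ω))]
  rw [div_le_iff₀ ht]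
  calc _ ≤ N * ∑ i, (disp ω i : ℝ) ^ 2 := h1
    _ ≤ N * ∑ i, 2 * t ^ 2 * (dev t true i ω ^ 2 + dev t false i ω ^ 2) := by
      gcongr with i
      exact h2 i
    _ = _ := by rw [← Finset.mul_sum, devSq]; ring

/-- Rescale `r = √t ρ`, use `ρ^α ≤ 1 + ρ`, then Young's inequality; only second moments remain. -/
lemma mul_rpow_le {w r α : ℝ} (ht : 0 < t) (hw : 0 ≤ w) (hr : 0 ≤ r) (hα0 : 0 ≤ α)
    (hα1 : α ≤ 1) : w * r ^ α ≤ t ^ (α / 2) * (1 + w ^ 2 + r ^ 2 / t) := by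
  have hs : 0 < √t := Real.sqrt_pos.2 ht
  obtain ⟨ρ, hρ⟩ : ∃ ρ, ρ = r / √t := ⟨_, rfl⟩
  have hρ0 : 0 ≤ ρ := by rw [hρ]; positivity
  have hr' : r = √t * ρ := by rw [hρ]; field_simp
  have h1 : r ^ 2 / t = ρ ^ 2 := by
    rw [hr', mul_pow, Real.sq_sqrt ht.le]; field_simp
  have h2 : r ^ α = t ^ (α / 2) * ρ ^ α := by
    rw [hr', Real.mul_rpow hs.le hρ0, Real.sqrt_eq_rpow, ← Real.rpow_mul ht.le]
    congr 2; ring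
  have h3 : ρ ^ α ≤ 1 + ρ := by
    rcases le_total ρ 1 with h | h
    · linarith [Real.rpow_le_one hρ0 h hα0]
    · have := Real.rpow_le_rpow_of_exponent_le h hα1
      rw [Real.rpow_one] at this
      linarith
  rw [h1, h2]
  calc _ = t ^ (α / 2) * (w * ρ ^ α) := by ring
    _ ≤ t ^ (α / 2) * (w * (1 + ρ)) := by gcongr
    _ ≤ _ := by
      gcongr
      nlinarith [sq_nonneg (w - 1), sq_nonneg (w - ρ), sq_nonneg ρ]

/-- A weight of second moment one integrates the `α`-th power of the displacement to
`O(t^{α/2})`. -/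
lemma norm_le_of_hasSum_holder {E : Type*} [NormedAddCommGroup E] (ht : 0 < t) {α A c : ℝ}
    (hα0 : 0 ≤ α) (hα1 : α ≤ 1) (hA : 0 ≤ A) (hc : 0 ≤ c) {w : (Fin N → ℕ × ℕ) → ℝ}
    (hw0 : ∀ ω, 0 ≤ w ω) (hw : HasSum (fun ω => poisWeight t ω * w ω ^ 2) 1)
    {F : (Fin N → ℕ × ℕ) → E} {x : E} (hF : HasSum F x)
    (hle : ∀ ω, ‖F ω‖ ≤ poisWeight t ω * (c * w ω * (A * latticeNorm (disp ω) ^ α))) :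
    ‖x‖ ≤ (2 + 4 * N ^ 2) * A * (c * t ^ (α / 2)) := by
  -- The constant `2 + 4N²` is total mass `1`, plus the second moment `1` of `w`, plus `2Nt · 2N/t`
  -- from the displacement.
  have h := ((hasSum_poisWeight (N := N) ht).add (hw.add
    ((hasSum_devSq ht).mul_left (2 * N * t)))).mul_left (A * (c * t ^ (α / 2)))
  refine (hF.norm_le_of_bounded h fun ω => (hle ω).trans ?_).trans (le_of_eq ?_)
  · have hP := poisWeight_nonneg ht ω
    have h1 := mul_rpow_le ht (hw0 ω) (latticeNorm_nonneg (disp ω)) hα0 hα1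
    have h2 := latticeNorm_disp_sq_le ht ω
    have h3 : w ω * latticeNorm (disp ω) ^ α
        ≤ t ^ (α / 2) * (1 + w ω ^ 2 + 2 * N * t * devSq t ω) := h1.trans (by gcongr)
    calc _ = poisWeight t ω * (c * A * (w ω * latticeNorm (disp ω) ^ α)) := by ring
      _ ≤ poisWeight t ω
          * (c * A * (t ^ (α / 2) * (1 + w ω ^ 2 + 2 * N * t * devSq t ω))) := by gcongr
      _ = _ := by ring
  · field_simp
    ring

end Moments

/-- `f` is `α`-Hölder on the lattice with constant `A`. -/
def HolderBound {N : ℕ} {E : Type*} [NormedAddCommGroup E] (A α : ℝ) (f : (Fin N → ℤ) → E) :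
    Prop :=
  ∀ n m, ‖f n - f m‖ ≤ A * latticeNorm (n - m) ^ α

lemma HolderBound.norm_sub_disp_le {N : ℕ} {E : Type*} [NormedAddCommGroup E]
    {A α : ℝ} {f : (Fin N → ℤ) → E} (h : HolderBound A α f) (n : Fin N → ℤ)
    (ω : Fin N → ℕ × ℕ) : ‖f (n - disp ω) - f n‖ ≤ A * latticeNorm (disp ω) ^ α := by
  have := h (n - disp ω) n
  have h2 : latticeNorm (n - disp ω - n) = latticeNorm (disp ω) := by
    rw [sub_sub_cancel_left]
    simp only [latticeNorm, Pi.neg_apply, Int.cast_neg, abs_neg]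
  rwa [h2] at this

/-! ### Hölder estimates for the heat semigroup and its differences -/

section HeatEstimates

variable {N : ℕ} {E : Type*} [NormedAddCommGroup E] [NormedSpace ℝ E] [CompleteSpace E]
  {σ α A t : ℝ} {f : (Fin N → ℤ) → E}

/-- `W_t` averages translates: the same displacement is used at `n` and `m`, so their difference is
unchanged. -/
lemma HolderBound.holderBound_heatSemigroup (h : HolderBound A α f) (hσ0 : 0 < σ) (hσN : 2 * σ < N)
    (hf : MemEll σ f) (ht : 0 < t) : HolderBound A α (heatSemigroup t f) := by
  intro n m
  have h1 := (hf.hasSum_heatSemigroup hσ0 hσN n ht).sub (hf.hasSum_heatSemigroup hσ0 hσN m ht)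
  have h2 := (hasSum_poisWeight (N := N) ht).mul_right (A * latticeNorm (n - m) ^ α)
  refine (h1.norm_le_of_bounded h2 fun ω => ?_).trans (one_mul _).le
  rw [← smul_sub, norm_smul, Real.norm_of_nonneg (poisWeight_nonneg ht ω)]
  refine mul_le_mul_of_nonneg_left ?_ (poisWeight_nonneg ht ω)
  have := h (n - disp ω) (m - disp ω)
  rwa [sub_sub_sub_cancel_right] at this

/-- Adding a particle to `Y_i` moves the sampled point by `+e_i`, so Stein's identity is summation
by parts. -/
lemma MemEll.hasSum_diff_heatSemigroup (hf : MemEll σ f) (hσ0 : 0 < σ) (hσN : 2 * σ < N)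
    (ht : 0 < t) (i : Fin N) (n : Fin N → ℤ) :
    HasSum (fun ω => (poisWeight t ω * dev t false i ω) • f (n - disp ω))
      (diff i (heatSemigroup t f) n) := by
  refine hasSum_of_eq (hasSum_dev_smul ht false i (h := fun ω => f (n - disp ω)) ?_
    (hf.hasSum_heatSemigroup hσ0 hσN n ht)) (fun ω => rfl) rfl
  refine hasSum_of_eq (hf.hasSum_heatSemigroup hσ0 hσN (n + Pi.single i 1) ht) (fun ω => ?_) rfl
  rw [disp_addParticle_false]
  congr 2
  abel

/-- The second difference is taken through `X_j` rather than `Y_j`, which keeps the two weights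
independent even for `i = j`. A particle of `X_j` moves the sampled point by `-e_j`, hence the base
point `n + e_j` and the minus sign. -/
lemma MemEll.hasSum_diff_diff_heatSemigroup (hf : MemEll σ f) (hσ0 : 0 < σ) (hσN : 2 * σ < N)
    (ht : 0 < t) (i j : Fin N) (n : Fin N → ℤ) :
    HasSum (fun ω => (poisWeight t ω * dev t true j ω) •
        (dev t false i ω • f (n + Pi.single j 1 - disp ω)))
      (-diff j (diff i (heatSemigroup t f)) n) := by
  refine hasSum_of_eq (hasSum_dev_smul ht true j
    (h := fun ω => dev t false i ω • f (n + Pi.single j 1 - disp ω))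
    (x := diff i (heatSemigroup t f) n)
    (y := diff i (heatSemigroup t f) (n + Pi.single j 1)) ?_ ?_)
    (fun ω => rfl) (neg_sub _ _).symm
  · refine hasSum_of_eq (hf.hasSum_diff_heatSemigroup hσ0 hσN ht i n) (fun ω => ?_) rfl
    rw [disp_addParticle_true, dev_addParticle_of_ne t (by decide), mul_smul,
      show n + Pi.single j 1 - (disp ω + Pi.single j 1) = n - disp ω by abel]
  · exact hasSum_of_eq (hf.hasSum_diff_heatSemigroup hσ0 hσN ht i (n + Pi.single j 1))
      (fun ω => mul_smul _ _ _) rfl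

lemma HolderBound.norm_diff_heatSemigroup_le (h : HolderBound A α f) (hA : 0 ≤ A) (hα0 : 0 ≤ α)
    (hα1 : α ≤ 1) (hσ0 : 0 < σ) (hσN : 2 * σ < N) (hf : MemEll σ f) (ht : 0 < t) (i : Fin N)
    (n : Fin N → ℤ) :
    ‖diff i (heatSemigroup t f) n‖
      ≤ (2 + 4 * N ^ 2) * A * t ^ ((α - 1) / 2) := by
  have hs : 0 < √t := Real.sqrt_pos.2 ht
  -- The deviation has mean zero, so `f n` can be subtracted at no cost and the Hölder bound
  -- applies.
  have hF := (hf.hasSum_diff_heatSemigroup hσ0 hσN ht i n).sub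
    ((hasSum_dev ht false i).smul_const (f n))
  rw [zero_smul, sub_zero] at hF
  have key := norm_le_of_hasSum_holder ht hα0 hα1 hA (c := (√t)⁻¹) (by positivity)
    (w := fun ω => √t * |dev t false i ω|) (fun ω => by positivity) ?_ hF fun ω => ?_
  · refine key.trans (le_of_eq ?_)
    rw [Real.sqrt_eq_rpow, ← Real.rpow_neg ht.le, ← Real.rpow_add ht]
    congr 2; ring
  · refine hasSum_of_eq ((hasSum_dev_sq ht false i).mul_left t) (fun ω => ?_) (by field_simp)
    rw [mul_pow, Real.sq_sqrt ht.le, sq_abs]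
    ring
  · rw [← smul_sub, norm_smul, norm_mul, Real.norm_of_nonneg (poisWeight_nonneg ht ω),
      inv_mul_cancel_left₀ hs.ne', mul_assoc, Real.norm_eq_abs]
    have := poisWeight_nonneg ht ω
    gcongr
    exact h.norm_sub_disp_le n ω

lemma HolderBound.norm_diff_diff_heatSemigroup_le (h : HolderBound A α f) (hA : 0 ≤ A)
    (hα0 : 0 ≤ α) (hα1 : α ≤ 1) (hσ0 : 0 < σ) (hσN : 2 * σ < N) (hf : MemEll σ f) (ht : 0 < t)
    (i j : Fin N) (n : Fin N → ℤ) :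
    ‖diff j (diff i (heatSemigroup t f)) n‖
      ≤ (2 + 4 * N ^ 2) * A * t ^ (α / 2 - 1) := by
  have htf : true ≠ false := by decide
  have hF := (hf.hasSum_diff_diff_heatSemigroup hσ0 hσN ht i j n).sub
    ((hasSum_dev_mul_dev ht htf j i).smul_const (f (n + Pi.single j 1)))
  rw [zero_smul, sub_zero] at hF
  -- A product of two deviations has second moment `1/t²`; multiplying by `t` normalizes it, and `c
  -- = t⁻¹` restores it.
  have key := norm_le_of_hasSum_holder ht hα0 hα1 hA (c := t⁻¹) (by positivity)
    (w := fun ω => t * |dev t true j ω * dev t false i ω|) (fun ω => by positivity) ?_ hF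
    fun ω => ?_
  · rw [norm_neg] at key
    refine key.trans (le_of_eq ?_)
    rw [Real.rpow_sub_one ht.ne', div_eq_inv_mul _ t]
  · refine hasSum_of_eq ((hasSum_dev_sq_mul_dev_sq ht htf j i).mul_left (t ^ 2)) (fun ω => ?_)
      (by field_simp)
    rw [mul_pow t, sq_abs]
    ring
  · rw [smul_smul, mul_assoc (poisWeight t ω), ← smul_sub, norm_smul, norm_mul,
      Real.norm_of_nonneg (poisWeight_nonneg ht ω), inv_mul_cancel_left₀ ht.ne',
      mul_assoc (poisWeight t ω), Real.norm_eq_abs]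
    have := poisWeight_nonneg ht ω
    gcongr
    exact h.norm_sub_disp_le _ ω

end HeatEstimates

end DiscreteLaplacian


namespace DiscreteLaplacian

/-! ### From bounded differences to Lipschitz bounds -/

section Lipschitz

variable {N : ℕ} {E : Type*} [NormedAddCommGroup E]

lemma norm_add_single_natCast_sub_le {u : (Fin N → ℤ) → E} {B : ℝ} {i : Fin N}
    (hu : ∀ n, ‖diff i u n‖ ≤ B) (k : ℕ) (n : Fin N → ℤ) :
    ‖u (n + Pi.single i (k : ℤ)) - u n‖ ≤ B * k := by
  induction k with
  | zero => simp
  | succ k ih =>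
    have h1 := hu (n + Pi.single i (k : ℤ))
    have h2 : diff i u (n + Pi.single i (k : ℤ))
        = u (n + Pi.single i ((k + 1 : ℕ) : ℤ)) - u (n + Pi.single i (k : ℤ)) := by
      rw [diff, fwdDiff, add_assoc, ← Pi.single_add]
      push_cast
      rfl
    rw [h2] at h1
    calc _ = ‖(u (n + Pi.single i ((k + 1 : ℕ) : ℤ)) - u (n + Pi.single i (k : ℤ)))
          + (u (n + Pi.single i (k : ℤ)) - u n)‖ := by rw [sub_add_sub_cancel]
      _ ≤ B + B * k := (norm_add_le _ _).trans (add_le_add h1 ih)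
      _ = _ := by push_cast; ring

lemma norm_add_single_sub_le {u : (Fin N → ℤ) → E} {B : ℝ} {i : Fin N}
    (hu : ∀ n, ‖diff i u n‖ ≤ B) (z : ℤ) (n : Fin N → ℤ) :
    ‖u (n + Pi.single i z) - u n‖ ≤ B * |(z : ℝ)| := by
  obtain ⟨k, rfl | rfl⟩ := z.eq_nat_or_neg
  · simpa using norm_add_single_natCast_sub_le hu k n
  · have := norm_add_single_natCast_sub_le hu k (n + Pi.single i (-(k : ℤ)))
    rw [add_assoc, ← Pi.single_add, neg_add_cancel, Pi.single_zero, add_zero, norm_sub_rev] at this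
    simpa using this

/-- Bounded forward differences give a Lipschitz bound in the lattice norm. -/
lemma norm_sub_le_of_diff_le {u : (Fin N → ℤ) → E} {B : ℝ} (hu : ∀ i n, ‖diff i u n‖ ≤ B)
    (n m : Fin N → ℤ) : ‖u n - u m‖ ≤ B * latticeNorm (n - m) := by
  have key : ∀ s : Finset (Fin N), ‖u (m + ∑ i ∈ s, Pi.single i ((n - m) i)) - u m‖
      ≤ B * ∑ i ∈ s, |((n - m) i : ℝ)| := by
    intro s
    induction s using Finset.induction_on with
    | empty => simp
    | insert i s hi ih =>
      rw [Finset.sum_insert hi, Finset.sum_insert hi, mul_add]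
      have h1 := norm_add_single_sub_le (hu i) ((n - m) i)
        (m + ∑ i ∈ s, Pi.single i ((n - m) i))
      rw [add_assoc, add_comm (∑ i ∈ s, _)] at h1
      calc _ = ‖(u (m + (Pi.single i ((n - m) i) + ∑ i ∈ s, Pi.single i ((n - m) i)))
            - u (m + ∑ i ∈ s, Pi.single i ((n - m) i)))
            + (u (m + ∑ i ∈ s, Pi.single i ((n - m) i)) - u m)‖ := by rw [sub_add_sub_cancel]
        _ ≤ _ := (norm_add_le _ _).trans (add_le_add h1 ih)
  have := key Finset.univ
  rwa [Finset.univ_sum_single, add_sub_cancel] at this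

end Lipschitz

/-! ### Schauder estimates for the fractional integral -/

section Schauder

variable {N : ℕ} {E : Type*} [NormedAddCommGroup E] [NormedSpace ℝ E] [CompleteSpace E]
  {σ α A : ℝ} {f : (Fin N → ℤ) → E}

lemma MemEll.fracIntegral_sub (hf : MemEll σ f) (hσ0 : 0 < σ) (hσN : 2 * σ < N)
    (n m : Fin N → ℤ) :
    fracIntegral σ f n - fracIntegral σ f m = (Real.Gamma σ)⁻¹ •
      ∫ t in Set.Ioi (0 : ℝ), t ^ (σ - 1) • (heatSemigroup t f n - heatSemigroup t f m) := by
  rw [fracIntegral, fracIntegral, ← smul_sub, ← integral_sub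
    (hf.integrableOn_heatSemigroup hσ0 hσN n) (hf.integrableOn_heatSemigroup hσ0 hσN m)]
  simp only [smul_sub]

lemma MemEll.heatSemigroup_diff (hf : MemEll σ f) (hσ0 : 0 < σ) (hσN : 2 * σ < N) {t : ℝ}
    (ht : 0 < t) (i : Fin N) (n : Fin N → ℤ) :
    heatSemigroup t (diff i f) n
      = heatSemigroup t f (n + Pi.single i 1) - heatSemigroup t f n := by
  have h1 := (hf.hasSum_heatSemigroup hσ0 hσN (n + Pi.single i 1) ht).sub
    (hf.hasSum_heatSemigroup hσ0 hσN n ht)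
  have hd : MemEll σ (diff i f) := (hf.comp_add hσN (Pi.single i 1)).sub hf
  refine (hd.hasSum_heatSemigroup hσ0 hσN n ht).unique (hasSum_of_eq h1 (fun ω => ?_) rfl)
  rw [← smul_sub, diff, fwdDiff, sub_add_eq_add_sub]

omit [NormedSpace ℝ E] [CompleteSpace E] in
lemma MemEll.memEll_diff (hf : MemEll σ f) (hσN : 2 * σ < N) (i : Fin N) :
    MemEll σ (diff i f) :=
  (hf.comp_add hσN (Pi.single i 1)).sub hf

lemma MemEll.fracIntegral_diff (hf : MemEll σ f) (hσ0 : 0 < σ) (hσN : 2 * σ < N) (i : Fin N) :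
    fracIntegral σ (diff i f)
      = diff i (fracIntegral σ f) := by
  funext n
  change _ = fracIntegral σ f (n + Pi.single i 1) - fracIntegral σ f n
  rw [hf.fracIntegral_sub hσ0 hσN, fracIntegral]
  congr 1
  refine setIntegral_congr_fun measurableSet_Ioi fun t ht => ?_
  simp only [hf.heatSemigroup_diff hσ0 hσN ht]

omit [CompleteSpace E] in
/-- Integration in time of a semigroup bound, split at `t = R²`. -/
lemma norm_fracIntegral_le {g : ℝ → E} {R B₁ B₂ p q : ℝ} (hR : 0 < R)
    (hg : IntegrableOn (fun t : ℝ => t ^ (σ - 1) • g t) (Set.Ioi 0))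
    (hp : 0 < σ + p) (hq : σ + q < 0)
    (h₁ : ∀ t, 0 < t → ‖g t‖ ≤ B₁ * t ^ p) (h₂ : ∀ t, 0 < t → ‖g t‖ ≤ B₂ * t ^ q) :
    ‖∫ t in Set.Ioi (0 : ℝ), t ^ (σ - 1) • g t‖
      ≤ B₁ * (R ^ (2 * (σ + p)) / (σ + p)) + B₂ * (R ^ (2 * (σ + q)) / (-(σ + q))) := by
  have hpow : ∀ {t B s : ℝ}, 0 < t → ‖g t‖ ≤ B * t ^ s →
      ‖t ^ (σ - 1) • g t‖ ≤ B * t ^ (σ - 1 + s) := by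
    intro t B s ht h
    rw [norm_smul, Real.norm_of_nonneg (Real.rpow_nonneg ht.le _), Real.rpow_add ht]
    calc _ ≤ t ^ (σ - 1) * (B * t ^ s) := by gcongr
      _ = _ := by ring
  have hR2 : ∀ s : ℝ, (R ^ 2) ^ s = R ^ (2 * s) := fun s => by
    rw [← Real.rpow_natCast R 2, ← Real.rpow_mul hR.le]; norm_num
  have key := (integrableOn_and_norm_integral_le hg.1 (T := R ^ 2) (B₁ := B₁) (B₂ := B₂)
    (p := σ - 1 + p) (q := σ - 1 + q) (by positivity) (by linarith) (by linarith)
    (fun t ht _ => hpow ht (h₁ t ht))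
    (fun t ht => hpow (lt_trans (by positivity) ht) (h₂ t (lt_trans (by positivity) ht)))).2
  rw [show σ - 1 + p + 1 = σ + p by ring, show σ - 1 + q + 1 = σ + q by ring, hR2, hR2] at key
  exact key

lemma latticeNorm_pos {n : Fin N → ℤ} (h : n ≠ 0) : 0 < latticeNorm n := by
  obtain ⟨i, hi⟩ := Function.ne_iff.1 h
  exact Finset.sum_pos' (fun _ _ => abs_nonneg _)
    ⟨i, Finset.mem_univ i, abs_pos.2 (Int.cast_ne_zero.2 hi)⟩

omit [NormedSpace ℝ E] [CompleteSpace E] in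
lemma HolderBound.of_ne {C β : ℝ} {u : (Fin N → ℤ) → E} (hC : 0 ≤ C)
    (h : ∀ n m, n ≠ m → ‖u n - u m‖ ≤ C * latticeNorm (n - m) ^ β) : HolderBound C β u := by
  intro n m
  by_cases hnm : n = m
  · rw [hnm, sub_self, norm_zero]
    exact mul_nonneg hC (Real.rpow_nonneg (latticeNorm_nonneg _) _)
  · exact h n m hnm

/-- The fractional integral gains `2σ` in the Hölder exponent. -/
lemma HolderBound.holderBound_fracIntegral (h : HolderBound A α f) (hA : 0 ≤ A) (hα0 : 0 ≤ α) (hσ0 : 0 < σ)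
    (hσN : 2 * σ < N) (hα : 2 * σ + α < 1) (hf : MemEll σ f) :
    HolderBound ((Real.Gamma σ)⁻¹ * (1 / σ + (2 + 4 * N ^ 2) / (1 / 2 - σ - α / 2)) * A)
      (2 * σ + α) (fracIntegral σ f) := by
  have hΓ : 0 < Real.Gamma σ := Real.Gamma_pos_of_pos hσ0
  have hd : 0 < 1 / 2 - σ - α / 2 := by linarith
  refine HolderBound.of_ne (by positivity) fun n m hnm => ?_
  have hR := latticeNorm_pos (sub_ne_zero.2 hnm)
  set R := latticeNorm (n - m) with hRdef
  -- Before `R²` the Hölder bound of `W_t f` is used as it is; after `R²`, its gradient bound times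
  -- `R`. The tail converges exactly when `2σ + α < 1`.
  have key := norm_fracIntegral_le (σ := σ) (g := fun t => heatSemigroup t f n - heatSemigroup t f m)
    (B₁ := A * R ^ α) (B₂ := (2 + 4 * N ^ 2) * A * R) (p := 0) (q := (α - 1) / 2) hR ?_
    (by linarith) (by linarith) (fun t ht => ?_) (fun t ht => ?_)
  · rw [hf.fracIntegral_sub hσ0 hσN, norm_smul, Real.norm_of_nonneg (by positivity), mul_assoc,
      mul_assoc]
    refine mul_le_mul_of_nonneg_left (key.trans (le_of_eq ?_)) (by positivity)
    have e1 : R ^ α * R ^ (2 * (σ + 0)) = R ^ (2 * σ + α) := by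
      rw [← Real.rpow_add hR]; congr 1; ring
    have e2 : R * R ^ (2 * (σ + (α - 1) / 2)) = R ^ (2 * σ + α) := by
      nth_rewrite 1 [← Real.rpow_one R]
      rw [← Real.rpow_add hR]; congr 1; ring
    rw [show -(σ + (α - 1) / 2) = 1 / 2 - σ - α / 2 by ring]
    rw [show R ^ (2 * (σ + 0)) = R ^ (2 * σ) by rw [add_zero]] at e1 ⊢
    rw [add_zero]
    linear_combination (A / σ) * e1
      + ((2 + 4 * (N : ℝ) ^ 2) * A / (1 / 2 - σ - α / 2)) * e2
  · simp only [smul_sub]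
    exact (hf.integrableOn_heatSemigroup hσ0 hσN n).sub (hf.integrableOn_heatSemigroup hσ0 hσN m)
  · rw [Real.rpow_zero, mul_one]
    exact h.holderBound_heatSemigroup hσ0 hσN hf ht n m
  · refine (norm_sub_le_of_diff_le (fun i k =>
      h.norm_diff_heatSemigroup_le hA hα0 (by linarith) hσ0 hσN hf ht i k) n m).trans (le_of_eq ?_)
    ring

/-- The fractional integral gains one difference once `2σ + α > 1`. -/
lemma HolderBound.holderBound_diff_fracIntegral (h : HolderBound A α f) (hA : 0 ≤ A) (hα0 : 0 ≤ α)
    (hα1 : α ≤ 1) (hσ0 : 0 < σ) (hσ1 : σ < 1 / 2) (hσN : 2 * σ < N) (hα : 1 < 2 * σ + α)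
    (hf : MemEll σ f) (i : Fin N) :
    HolderBound ((Real.Gamma σ)⁻¹ * ((2 + 4 * N ^ 2) *
        (2 / (σ + (α - 1) / 2) + 1 / (1 - σ - α / 2))) * A)
      (2 * σ + α - 1) (diff i (fracIntegral σ f)) := by
  have hΓ : 0 < Real.Gamma σ := Real.Gamma_pos_of_pos hσ0
  have hd1 : 0 < σ + (α - 1) / 2 := by linarith
  have hd2 : 0 < 1 - σ - α / 2 := by linarith
  have hfi := hf.memEll_diff hσN i
  have hW : ∀ t : ℝ, 0 < t → heatSemigroup t (diff i f)
      = diff i (heatSemigroup t f) := fun t ht =>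
    funext fun n => hf.heatSemigroup_diff hσ0 hσN ht i n
  refine HolderBound.of_ne (by positivity) fun n m hnm => ?_
  have hR := latticeNorm_pos (sub_ne_zero.2 hnm)
  set R := latticeNorm (n - m) with hRdef
  -- One derivative higher than in the other regime: before `R²` the two gradients are bounded
  -- separately, whence the factor `2`, with integrability at `0` from `2σ + α > 1`; after `R²` the
  -- second differences are used.
  have key := norm_fracIntegral_le (σ := σ)
    (g := fun t => heatSemigroup t (diff i f) n
      - heatSemigroup t (diff i f) m)
    (B₁ := 2 * ((2 + 4 * N ^ 2) * A)) (B₂ := (2 + 4 * N ^ 2) * A * R) (p := (α - 1) / 2)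
    (q := α / 2 - 1) hR ?_ (by linarith) (by linarith) (fun t ht => ?_) (fun t ht => ?_)
  · rw [← hf.fracIntegral_diff hσ0 hσN, hfi.fracIntegral_sub hσ0 hσN, norm_smul,
      Real.norm_of_nonneg (by positivity), mul_assoc, mul_assoc]
    refine mul_le_mul_of_nonneg_left (key.trans (le_of_eq ?_)) (by positivity)
    have e1 : R ^ (2 * (σ + (α - 1) / 2)) = R ^ (2 * σ + α - 1) := by congr 1; ring
    have e2 : R * R ^ (2 * (σ + (α / 2 - 1))) = R ^ (2 * σ + α - 1) := by
      nth_rewrite 1 [← Real.rpow_one R]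
      rw [← Real.rpow_add hR]; congr 1; ring
    rw [show -(σ + (α / 2 - 1)) = 1 - σ - α / 2 by ring, e1]
    linear_combination ((2 + 4 * (N : ℝ) ^ 2) * A / (1 - σ - α / 2)) * e2
  · simp only [smul_sub]
    exact (hfi.integrableOn_heatSemigroup hσ0 hσN n).sub (hfi.integrableOn_heatSemigroup hσ0 hσN m)
  · have hb := h.norm_diff_heatSemigroup_le hA hα0 hα1 hσ0 hσN hf ht i
    simp only [hW t ht]
    refine (norm_sub_le _ _).trans ((add_le_add (hb n) (hb m)).trans (le_of_eq ?_))
    ring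
  · simp only [hW t ht]
    refine (norm_sub_le_of_diff_le (fun j k =>
      h.norm_diff_diff_heatSemigroup_le hA hα0 hα1 hσ0 hσN hf ht i j k) n m).trans (le_of_eq ?_)
    ring

lemma MemEll.iterate_diff (hf : MemEll σ f) (hσ0 : 0 < σ) (hσN : 2 * σ < N) (i : Fin N) (k : ℕ) :
    MemEll σ ((diff i)^[k] f) ∧
      fracIntegral σ ((diff i)^[k] f)
        = (diff i)^[k] (fracIntegral σ f) := by
  induction k with
  | zero => exact ⟨hf, rfl⟩
  | succ k ih =>
    rw [Function.iterate_succ_apply', Function.iterate_succ_apply', ← ih.2]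
    exact ⟨ih.1.memEll_diff hσN i, ih.1.fracIntegral_diff hσ0 hσN i⟩

/-- Differences commute with the convolution and preserve `ℓ_σ`; this reduces all orders `k` to
estimates on `iterDiff m f`. -/
lemma MemEll.memEll_iterDiff (hf : MemEll σ f) (hσ0 : 0 < σ) (hσN : 2 * σ < N) (m : Fin N → ℕ) :
    MemEll σ (iterDiff m f) ∧
      fracIntegral σ (iterDiff m f)
        = iterDiff m (fracIntegral σ f) := by
  unfold iterDiff
  induction List.finRange N with
  | nil => exact ⟨hf, rfl⟩
  | cons i l ih =>
    simp only [List.foldr_cons]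
    rw [← ih.2]
    exact ih.1.iterate_diff hσ0 hσN i (m i)

end Schauder

/-! ### Multi-index differences and conversion to seminorms -/

section IterDiff

variable {N : ℕ} {E : Type*} [NormedAddCommGroup E]

lemma diff_comm (i j : Fin N) (f : (Fin N → ℤ) → E) : diff i (diff j f) = diff j (diff i f) := by
  funext n
  simp only [diff, fwdDiff]
  rw [add_right_comm n (Pi.single i 1)]
  abel

/-- In a list without repetition the extra difference occurs at most once, and commutation carries
it to the front. -/
lemma foldr_diff_add_single (m : Fin N → ℕ) (i : Fin N) (f : (Fin N → ℤ) → E)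
    (l : List (Fin N)) (hl : l.Nodup) :
    l.foldr (fun j g => (diff j)^[(m + Pi.single i 1 : Fin N → ℕ) j] g) f =
      if i ∈ l then diff i (l.foldr (fun j g => (diff j)^[m j] g) f)
      else l.foldr (fun j g => (diff j)^[m j] g) f := by
  induction l with
  | nil => simp
  | cons j l ih =>
    rw [List.nodup_cons] at hl
    simp only [List.foldr_cons, ih hl.2]
    by_cases hij : i = j
    · subst hij
      rw [if_neg hl.1, if_pos List.mem_cons_self, Pi.add_apply, Pi.single_eq_same,
        Function.iterate_succ_apply']
    · have h1 : (m + Pi.single i 1 : Fin N → ℕ) j = m j := by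
        rw [Pi.add_apply, Pi.single_eq_of_ne (Ne.symm hij), add_zero]
      rw [h1]
      by_cases hmem : i ∈ l
      · rw [if_pos hmem, if_pos (List.mem_cons_of_mem _ hmem)]
        exact (Function.Commute.iterate_left
          (fun g : (Fin N → ℤ) → E => diff_comm j i g) (m j)) _
      · rw [if_neg hmem, if_neg (by simp [hij, hmem])]

lemma iterDiff_add_single (m : Fin N → ℕ) (i : Fin N) (f : (Fin N → ℤ) → E) :
    iterDiff (m + Pi.single i 1) f = diff i (iterDiff m f) := by
  rw [iterDiff, foldr_diff_add_single m i f _ (List.nodup_finRange N),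
    if_pos (List.mem_finRange i), iterDiff]

lemma holderSeminormZero_le {C α : ℝ} {f : (Fin N → ℤ) → E} (h : HolderBound C α f) :
    holderSeminormZero α f ≤ ENNReal.ofReal C := by
  refine iSup_le fun n => iSup_le fun m => iSup_le fun hnm => ENNReal.ofReal_le_ofReal ?_
  have hR := latticeNorm_pos (sub_ne_zero.2 hnm)
  rw [div_le_iff₀ (Real.rpow_pos_of_pos hR _)]
  exact h n m

lemma holderBound_of_lt_top {α : ℝ} {f : (Fin N → ℤ) → E} (h : holderSeminormZero α f < ∞) :
    HolderBound (holderSeminormZero α f).toReal α f := by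
  refine HolderBound.of_ne ENNReal.toReal_nonneg fun n m hnm => ?_
  have hR := latticeNorm_pos (sub_ne_zero.2 hnm)
  rw [← div_le_iff₀ (Real.rpow_pos_of_pos hR _), ← ENNReal.ofReal_le_iff_le_toReal h.ne]
  exact le_iSup_of_le n (le_iSup_of_le m (le_iSup_of_le hnm le_rfl))

lemma holderSeminorm_zero (α : ℝ) (f : (Fin N → ℤ) → E) :
    holderSeminorm 0 α f = holderSeminormZero α f := by
  have h : ∀ l : List (Fin N), l.foldr (fun i g => (diff i)^[(0 : Fin N → ℕ) i] g) f = f := by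
    intro l
    induction l with
    | nil => rfl
    | cons i l ih => simp
  rw [holderSeminorm, Finset.piAntidiag_zero, Finset.sum_singleton, iterDiff, h]

lemma MemHolder.of_le {k l : ℕ} {α β : ℝ} {C : ℝ≥0} {f g : (Fin N → ℤ) → E}
    (hf : MemHolder k α f) (h : holderSeminorm l β g ≤ C * holderSeminorm k α f) :
    MemHolder l β g ∧ holderSeminorm l β g ≤ C * holderSeminorm k α f :=
  ⟨h.trans_lt (ENNReal.mul_lt_top ENNReal.coe_lt_top hf), h⟩

end IterDiff

/-! ### Summation over multi-indices -/

section Seminorms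

variable {N : ℕ} {E : Type*} [NormedAddCommGroup E] [NormedSpace ℝ E] [CompleteSpace E]
  {σ α : ℝ}

lemma exists_holderSeminorm_fracIntegral_le (hσ0 : 0 < σ) (hσN : 2 * σ < N) (k : ℕ)
    (hα0 : 0 ≤ α) (hα : 2 * σ + α < 1) :
    ∃ C : ℝ≥0, ∀ f : (Fin N → ℤ) → E, MemEll σ f → MemHolder k α f →
      holderSeminorm k (2 * σ + α) (fracIntegral σ f) ≤ C * holderSeminorm k α f := by
  refine ⟨Real.toNNReal ((Real.Gamma σ)⁻¹ * (1 / σ + (2 + 4 * N ^ 2) / (1 / 2 - σ - α / 2))),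
    fun f hf hH => ?_⟩
  rw [holderSeminorm, holderSeminorm, Finset.mul_sum]
  refine Finset.sum_le_sum fun m hm => ?_
  have hfin : holderSeminormZero α (iterDiff m f) < ∞ := ENNReal.sum_lt_top.1 hH m hm
  obtain ⟨hell, hcomm⟩ := hf.memEll_iterDiff hσ0 hσN m
  rw [← hcomm]
  refine (holderSeminormZero_le ((holderBound_of_lt_top hfin).holderBound_fracIntegral ENNReal.toReal_nonneg
    hα0 hσ0 hσN hα hell)).trans (le_of_eq ?_)
  rw [ENNReal.ofReal_mul' ENNReal.toReal_nonneg, ENNReal.ofReal_toReal hfin.ne]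
  rfl

lemma exists_holderSeminorm_succ_fracIntegral_le (hσ0 : 0 < σ) (hσ1 : σ < 1 / 2)
    (hσN : 2 * σ < N) (k : ℕ) (hα0 : 0 ≤ α) (hα1 : α ≤ 1) (hα : 1 < 2 * σ + α) :
    ∃ C : ℝ≥0, ∀ f : (Fin N → ℤ) → E, MemEll σ f → MemHolder k α f →
      holderSeminorm (k + 1) (2 * σ + α - 1) (fracIntegral σ f) ≤ C * holderSeminorm k α f := by
  set c : ℝ≥0 := Real.toNNReal ((Real.Gamma σ)⁻¹ * ((2 + 4 * N ^ 2) *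
    (2 / (σ + (α - 1) / 2) + 1 / (1 - σ - α / 2)))) with hc
  -- Each multi-index of order `k + 1` is some `m' + e_i` with `m'` of order `k`, and its term is
  -- bounded by `c` times the whole seminorm; the cardinality counts these terms.
  refine ⟨(Finset.piAntidiag (Finset.univ : Finset (Fin N)) (k + 1)).card * c,
    fun f hf hH => ?_⟩
  rw [holderSeminorm]
  refine (Finset.sum_le_card_nsmul _ _ (c * holderSeminorm k α f) fun m hm => ?_).trans
    (le_of_eq (by rw [nsmul_eq_mul]; push_cast; ring))
  rw [Finset.mem_piAntidiag] at hm
  obtain ⟨i, -, hi⟩ : ∃ i ∈ Finset.univ, m i ≠ 0 :=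
    Finset.exists_ne_zero_of_sum_ne_zero (by rw [hm.1]; omega)
  obtain ⟨m', rfl⟩ : ∃ m', m = m' + Pi.single i 1 := by
    refine ⟨m - Pi.single i 1, (tsub_add_cancel_of_le fun j => ?_).symm⟩
    by_cases hj : j = i
    · subst hj
      rw [Pi.single_eq_same]
      exact Nat.one_le_iff_ne_zero.2 hi
    · rw [Pi.single_eq_of_ne hj]
      exact Nat.zero_le _
  have hm' : m' ∈ Finset.piAntidiag (Finset.univ : Finset (Fin N)) k := by
    rw [Finset.mem_piAntidiag]
    refine ⟨?_, fun _ _ => Finset.mem_univ _⟩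
    have h := hm.1
    simp only [Pi.add_apply, Finset.sum_add_distrib, Finset.sum_pi_single', Finset.mem_univ,
      if_true] at h
    exact Nat.succ_injective h
  have hfin : holderSeminormZero α (iterDiff m' f) < ∞ := ENNReal.sum_lt_top.1 hH m' hm'
  obtain ⟨hell, hcomm⟩ := hf.memEll_iterDiff hσ0 hσN m'
  rw [iterDiff_add_single, ← hcomm]
  refine (holderSeminormZero_le ((holderBound_of_lt_top hfin).holderBound_diff_fracIntegral
    ENNReal.toReal_nonneg hα0 hα1 hσ0 hσ1 hσN hα hell i)).trans ?_
  rw [ENNReal.ofReal_mul' ENNReal.toReal_nonneg, ENNReal.ofReal_toReal hfin.ne]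
  refine mul_le_mul le_rfl ?_ zero_le zero_le
  exact Finset.single_le_sum (f := fun m => holderSeminormZero α (iterDiff m f))
    (fun _ _ => zero_le) hm'

end Seminorms

end DiscreteLaplacian

theorem mainTheorem6 {𝕜 : Type*} [RCLike 𝕜] (N : ℕ) (hN : 1 ≤ N)
    (σ : ℝ) (hσ0 : 0 < σ) (hσ1 : σ < 1 / 2) :
    -- the fractional integral of every `f ∈ ℓ_σ` is well defined
    (∀ f : (Fin N → ℤ) → 𝕜, DiscreteLaplacian.MemEll σ f → ∀ n : Fin N → ℤ,
      (∀ t : ℝ, 0 < t → Summable fun k => DiscreteLaplacian.heatKernel t (n - k) • f k) ∧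
      IntegrableOn (fun t : ℝ => t ^ (σ - 1) • DiscreteLaplacian.heatSemigroup t f n)
        (Set.Ioi 0)) ∧
    -- a)
    (∀ (k : ℕ) (α : ℝ), 0 < α → α ≤ 1 → 2 * σ + α < 1 →
      ∃ C : ℝ≥0, ∀ f : (Fin N → ℤ) → 𝕜, DiscreteLaplacian.MemEll σ f →
        DiscreteLaplacian.MemHolder k α f →
        DiscreteLaplacian.MemHolder k (2 * σ + α) (DiscreteLaplacian.fracIntegral σ f) ∧
        DiscreteLaplacian.holderSeminorm k (2 * σ + α) (DiscreteLaplacian.fracIntegral σ f) ≤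
          C * DiscreteLaplacian.holderSeminorm k α f) ∧
    -- b)
    (∀ (k : ℕ) (α : ℝ), 0 < α → α ≤ 1 → 1 < 2 * σ + α →
      ∃ C : ℝ≥0, ∀ f : (Fin N → ℤ) → 𝕜, DiscreteLaplacian.MemEll σ f →
        DiscreteLaplacian.MemHolder k α f →
        DiscreteLaplacian.MemHolder (k + 1) (2 * σ + α - 1)
          (DiscreteLaplacian.fracIntegral σ f) ∧
        DiscreteLaplacian.holderSeminorm (k + 1) (2 * σ + α - 1)
          (DiscreteLaplacian.fracIntegral σ f) ≤
          C * DiscreteLaplacian.holderSeminorm k α f) ∧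
    -- c)
    (∃ C : ℝ≥0, ∀ f : lp (fun _ : Fin N → ℤ => 𝕜) ∞, DiscreteLaplacian.MemEll σ (fun n => f n) →
      DiscreteLaplacian.MemHolder 0 (2 * σ) (DiscreteLaplacian.fracIntegral σ (fun n => f n)) ∧
      DiscreteLaplacian.holderSeminorm 0 (2 * σ)
        (DiscreteLaplacian.fracIntegral σ (fun n => f n)) ≤ C * ‖f‖ₑ) := by
  have hσN : 2 * σ < N := by
    have : (1 : ℝ) ≤ N := by exact_mod_cast hN
    linarith
  refine ⟨fun f hf n => ⟨fun t ht => hf.summable_heatKernel_smul hσ0 hσN n ht,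
    hf.integrableOn_heatSemigroup hσ0 hσN n⟩, fun k α hα0 _ hα => ?_, fun k α hα0 hα1 hα => ?_, ?_⟩
  · obtain ⟨C, hC⟩ := DiscreteLaplacian.exists_holderSeminorm_fracIntegral_le (N := N) (E := 𝕜)
      hσ0 hσN k hα0.le hα
    exact ⟨C, fun f hf hH => hH.of_le (hC f hf hH)⟩
  · obtain ⟨C, hC⟩ := DiscreteLaplacian.exists_holderSeminorm_succ_fracIntegral_le (N := N)
      (E := 𝕜) hσ0 hσ1 hσN k hα0.le hα1 hα
    exact ⟨C, fun f hf hH => hH.of_le (hC f hf hH)⟩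
  -- A bounded sequence is Hölder of exponent `0` with constant `2‖f‖`, so this is the constant of
  -- (a) at `α = 0`, doubled; the condition `2σ + 0 < 1` holds.
  · refine ⟨Real.toNNReal ((Real.Gamma σ)⁻¹ * (1 / σ + (2 + 4 * N ^ 2) / (1 / 2 - σ - 0 / 2)) * 2),
      fun f hf => ?_⟩
    have hb : DiscreteLaplacian.HolderBound (2 * ‖f‖) 0 (fun n => f n) := by
      intro n m
      rw [Real.rpow_zero, mul_one, two_mul]
      exact (norm_sub_le _ _).trans (add_le_add (lp.norm_apply_le_norm ENNReal.top_ne_zero f n)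
        (lp.norm_apply_le_norm ENNReal.top_ne_zero f m))
    have h := DiscreteLaplacian.holderSeminormZero_le
      (hb.holderBound_fracIntegral (by positivity) le_rfl hσ0 hσN (by linarith) hf)
    rw [← mul_assoc, ENNReal.ofReal_mul' (norm_nonneg _), ofReal_norm, add_zero,
      ← DiscreteLaplacian.holderSeminorm_zero] at h
    exact ⟨h.trans_lt (ENNReal.mul_lt_top ENNReal.ofReal_lt_top enorm_lt_top), h⟩
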